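/- Let $L=2\ell$ with $\ell\ge 1$ an integer, and let $\Gamma_L=\mathbb Z^2/L\mathbb Z^2$ be the discrete torus, with edges $(x,\mu)=(x,x+e_\mu)$, $x\in\Gamma_L$, $\mu\in\{1,2\}$. For a $\mathbb Z_2$ gauge field $\sigma=\{\sigma_{x,\mu}\}$, $\sigma_{x,\mu}\in\{\pm1\}$, and $t>0$, consider on the fermionic Fock space $\mathcal F_L$ over $\ell^2(\Gamma_L)$ the Hamiltonian $$H(\sigma)=-\sum_{\Lambda}\prod_{(x,\mu)\in\partial\Lambda}\sigma_{x,\mu}+H_f(\sigma),\qquad H_f(\sigma)=-t\sum_{x\in\Gamma_L}\sum_{\mu=1,2}\big(a^+_x\sigma_{x,\mu}a^-_{x+e_\mu}+\text{h.c.}\big),$$ where $\Lambda$ runs over the elementary plaquettes and $a^\pm_x$ are the creation and annihilation operators. With $N$ the number operator, define the even and odd partition functions at half filling and the corresponding ground-state energies by $$Z^+_{\beta,L}(\sigma)=\mathrm{Tr}\,e^{-\beta H(\sigma)},\qquad Z^-_{\beta,L}(\sigma)=\mathrm{Tr}\,(-1)^Ne^{-\beta H(\sigma)},\qquad E^{\varepsilon}_{0;L}(\sigma)=-\lim_{\beta\to\infty}\frac1\beta\log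 Z^{\varepsilon}_{\beta,L}(\sigma)\quad(\varepsilon=\pm1).$$ For $a,b\in\{\pm1\}$, write $Z^\varepsilon_{\beta,L}(\pi;a,b)$ and $E^\varepsilon_{0;L}(\pi;a,b)$ for these quantities at a gauge field $\sigma$ whose product around every elementary plaquette is $-1$, whose product along the circle $x_2=0$ is $a$, and whose product along the circle $x_1=0$ is $b$ (the statements hold for every such $\sigma$). Put $r=1$ if $\ell$ is even and $r=-1$ if $\ell$ is odd. Then: 1. For all $\beta>0$, $t>0$ and all $\ell \geq 1$, $$Z^-_{\beta,L}(\pi;r,r)=0,\qquad Z^-_{\beta,L}(\pi;a,b)>0\quad\text{for }(a,b)\ne(r,r).$$ 2. For every $0<\alpha<1/3$ there is a constant $C_\alpha>0$, depending only on $\alpha$, such that for all $t>0$, all $\ell\ge1$ and all $(\varepsilon,a,b)\ne(-1,r,r)$, the limits defining $E^\varepsilon_{0;L}(\pi;a,b)$ and $E^{+}_{0;L}(\pi;r,r)$ exist and are finite, and $$\big|E^{\varepsilon}_{0;L}(\pi;a,b)-E^{+}_{0;L}(\pi;r,r)\big|\le\frac{C_\alpha\,t}{L^{1-3\alpha}}.$$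 -/

import Mathlib

open scoped ComplexOrder

namespace LatticeGauge

/-! ## The torus and the `ℤ₂` gauge field -/

/-- The vertices of the discrete torus `Γ_L = ℤ² / L ℤ²`. -/
abbrev Site (L : ℕ) : Type := ZMod L × ZMod L

/-- The two lattice directions: `basisVec 0 = e₁` (horizontal), `basisVec 1 = e₂` (vertical). -/
def basisVec {L : ℕ} (μ : Fin 2) : Site L := if μ = 0 then (1, 0) else (0, 1)

/-- A configuration of `±1` spins on the edges `(x, μ) = (x, x + e_μ)` of the torus. -/
abbrev GaugeField (L : ℕ) : Type := Site L → Fin 2 → ℤˣ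

/-- The product of the four spins around the elementary plaquette with lower left corner `x`. -/
def plaquette {L : ℕ} (σ : GaugeField L) (x : Site L) : ℤˣ :=
  σ x 0 * σ (x + basisVec 0) 1 * σ (x + basisVec 1) 0 * σ x 1

/-- `σ` realizes the `π`-flux phase with boundary fluxes `(a, b)`: the product of the spins is `-1`
around every plaquette, it is `a` along the horizontal circle `x₂ = 0`, and it is `b` along the
vertical circle `x₁ = 0`. -/
structure IsPiFlux {L : ℕ} [NeZero L] (σ : GaugeField L) (a b : ℤˣ) : Prop where
  plaquette_eq : ∀ x : Site L, plaquette σ x = -1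
  horizontal_eq : ∏ i : ZMod L, σ (i, 0) 0 = a
  vertical_eq : ∏ j : ZMod L, σ (0, j) 1 = b

/-! ## Fermionic Fock space

The Fock space over `ℓ²(Γ_L)` is `ℂ ^ (2 ^ |Γ_L|)`, with its orthonormal occupation number basis
`|s⟩`, `s ⊆ Γ_L`. Operators on it are written as matrices in this basis. The signs of the creation
and annihilation operators refer to the enumeration `siteIndex` of the vertices. -/

/-- An enumeration of the vertices, used to order the one-particle states in `|s⟩`. -/
def siteIndex {L : ℕ} (x : Site L) : ℕ := x.2.val * L + x.1.val

/-- Operators on the fermionic Fock space over the torus, in the occupation number basis. -/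
abbrev FockOp (L : ℕ) : Type := Matrix (Finset (Site L)) (Finset (Site L)) ℂ

variable {L : ℕ}

/-- The annihilation operator `a⁻_x`: if `x ∈ s`, it maps `|s⟩` to `± |s \ {x}⟩`, the sign being
`-1` to the number of occupied sites before `x`; if `x ∉ s`, it maps `|s⟩` to `0`. -/
def annihilation (x : Site L) : FockOp L := fun s' s =>
  if x ∈ s ∧ s' = s.erase x then (-1) ^ (s.filter fun y => siteIndex y < siteIndex x).card else 0

/-- The creation operator `a⁺_x = (a⁻_x)^*`. -/
def creation (x : Site L) : FockOp L := (annihilation x).conjTranspose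

/-- The fermion parity `(-1)^N`, where `N |s⟩ = |s| |s⟩` is the number operator. -/
def parity : FockOp L := Matrix.diagonal fun s => (-1) ^ s.card

variable [NeZero L]

/-- The hopping term `a⁺_x σ_{x,μ} a⁻_{x+e_μ}`. -/
noncomputable def hopping (σ : GaugeField L) (x : Site L) (μ : Fin 2) : FockOp L :=
  (((σ x μ : ℤˣ) : ℤ) : ℂ) • (creation x * annihilation (x + basisVec μ))

/-- The matter Hamiltonian `H_f(σ) = -t ∑_x ∑_μ a⁺_x σ_{x,μ} a⁻_{x+e_μ} + h.c.` -/
noncomputable def matterHamiltonian (t : ℝ) (σ : GaugeField L) : FockOp L :=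
  -(t : ℂ) • ∑ x : Site L, ∑ μ : Fin 2, (hopping σ x μ + (hopping σ x μ).conjTranspose)

/-- The Hamiltonian `H(σ) = - ∑_Λ ∏_{(x,μ) ∈ ∂Λ} σ_{x,μ} + H_f(σ)` in the gauge field `σ`. -/
noncomputable def hamiltonian (t : ℝ) (σ : GaugeField L) : FockOp L :=
  (-∑ x : Site L, (((plaquette σ x : ℤˣ) : ℤ) : ℂ)) • (1 : FockOp L) + matterHamiltonian t σ

/-- The even partition function at half filling (`μ = 0`), `Z⁺ = Tr exp(-β H(σ))`. -/
noncomputable def evenPartition (t β : ℝ) (σ : GaugeField L) : ℂ :=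
  Matrix.trace (NormedSpace.exp (-(β : ℂ) • hamiltonian t σ))

/-- The odd partition function at half filling (`μ = 0`), `Z⁻ = Tr (-1)^N exp(-β H(σ))`. -/
noncomputable def oddPartition (t β : ℝ) (σ : GaugeField L) : ℂ :=
  Matrix.trace (parity * NormedSpace.exp (-(β : ℂ) • hamiltonian t σ))

/-- The partition function `Z^ε`, `ε = ±1`: even for `ε = 1`, odd for `ε = -1`. -/
noncomputable def partitionFn (ε : ℤˣ) (t β : ℝ) (σ : GaugeField L) : ℂ :=
  if ε = 1 then evenPartition t β σ else oddPartition t β σ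

/-- `-(1/β) log Z^ε_β(σ)`. The partition functions are real; this is only used when they are
positive. -/
noncomputable def freeEnergy (ε : ℤˣ) (t : ℝ) (σ : GaugeField L) (β : ℝ) : ℝ :=
  -(1 / β) * Real.log (partitionFn ε t β σ).re

/-- The ground state energy `E^ε₀(σ) = -lim_{β → ∞} (1/β) log Z^ε_β(σ)`. It is meaningful when the
limit exists. -/
noncomputable def groundStateEnergy (ε : ℤˣ) (t : ℝ) (σ : GaugeField L) : ℝ :=
  Filter.limUnder Filter.atTop (freeEnergy ε t σ)

/-- The limit defining the ground state energy exists (and is finite). -/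
def HasGroundStateEnergy (ε : ℤˣ) (t : ℝ) (σ : GaugeField L) : Prop :=
  Filter.Tendsto (freeEnergy ε t σ) Filter.atTop (nhds (groundStateEnergy ε t σ))

/-- The common value of the two boundary fluxes in the reference phase on the torus of side
`L = 2 ℓ`: it is `1` for even `ℓ` and `-1` for odd `ℓ`. -/
def refFlux (ℓ : ℕ) : ℤˣ := if Even ℓ then 1 else -1

end LatticeGauge

/-! The Hamiltonian is a constant plus a quadratic form in the fermions, so diagonalizing the
one-particle matrix `h = oneParticle t σ` gives `Z^ε = exp(-βL²) ∏ (1 + ε exp(-β e_k))`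
(`partitionFn_eq`). Everything reduces to the spectrum of `h`.

Flux `-1` through each plaquette makes the two covariant shifts anticommute (`shift_anticomm`).
Hence `h²` involves only the commuting unitaries `T_μ²` and their adjoints, whose `ℓ`-th powers are
the boundary fluxes. The squared energies are `4t²(sin² + sin²)` on an `ℓ × ℓ` momentum grid, each
with multiplicity 4 (`trace_oneParticle_pow`), and `T_0 T_1` anticommutes with `h`, so the spectrum
is symmetric. The flux shifts a grid direction by half a step exactly when it differs from
`refFlux`; zero is thus an eigenvalue only for `(r, r)`, where it kills `Z⁻`. Otherwise `2ℓ²`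
energies are negative, an even number, and `Z⁻ > 0`.

Each limit is `L² - ½ ∑ |e_k|`, so the energies differ by Riemann sums of a conical function on
shifted grids (`abs_coneSum_sub_le`). A row whose distance from the cone point is `c` contributes
`O(1/(ℓ²c))`; summing the rows gives `O(log ℓ / ℓ)`, and any positive power of `L` absorbs the
logarithm. -/

namespace LatticeGauge

open Matrix NormedSpace

/-! ### Canonical anticommutation relations and traces of quadratic exponentials -/

section CAR

variable {m : Type*} [Fintype m] [DecidableEq m]

/-- The exponential of a multiple of an idempotent matrix. -/
theorem exp_smul_of_idempotent (w : ℂ) (n : Matrix m m ℂ) (hn : n * n = n) :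
    exp (w • n) = 1 + (Complex.exp w - 1) • n := by
  have hpow : ∀ k : ℕ, n ^ (k + 1) = n := by
    intro k
    induction k with
    | zero => simp
    | succ k ih => rw [pow_succ, ih, hn]
  have h1 : HasSum (fun k : ℕ => (w ^ k / (k.factorial : ℂ)) • n) (Complex.exp w • n) := by
    rw [Complex.exp_eq_exp_ℂ]
    exact (NormedSpace.expSeries_div_hasSum_exp (𝔸 := ℂ) w).smul_const n
  -- The series for `exp w • n` has the wrong zeroth term `n`; adding `1 - n` there repairs it.
  have h2 := h1.add (hasSum_ite_eq (0 : ℕ) (1 - n))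
  rw [NormedSpace.exp_eq_tsum ℂ]
  have h3 : Complex.exp w • n + (1 - n) = 1 + (Complex.exp w - 1) • n := by
    rw [sub_smul, one_smul]; abel
  rw [← h3]
  refine HasSum.tsum_eq ?_
  have h4 : (fun k : ℕ => ((k.factorial : ℂ)⁻¹) • (w • n) ^ k) =
      fun k => (w ^ k / (k.factorial : ℂ)) • n + if k = 0 then 1 - n else 0 := by
    funext k
    cases k with
    | zero => simp
    | succ k =>
      rw [smul_pow, hpow, if_neg (Nat.succ_ne_zero k), add_zero, smul_smul, mul_comm,
        div_eq_mul_inv]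
  rw [h4]
  exact h2

/-- A finite family of matrices satisfying the canonical anticommutation relations. -/
structure IsCAR {κ : Type*} [DecidableEq κ] (b : κ → Matrix m m ℂ) : Prop where
  anticomm : ∀ k l, b k * b l + b l * b k = 0
  anticomm_star : ∀ k l, b k * (b l)ᴴ + (b l)ᴴ * b k = if k = l then 1 else 0

namespace IsCAR

variable {κ : Type*} [DecidableEq κ] {b : κ → Matrix m m ℂ}

theorem mul_self (hb : IsCAR b) (k : κ) : b k * b k = 0 := by
  have := hb.anticomm k k
  rwa [← two_smul ℂ, smul_eq_zero_iff_right two_ne_zero] at this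

theorem number_idempotent (hb : IsCAR b) (k : κ) :
    ((b k)ᴴ * b k) * ((b k)ᴴ * b k) = (b k)ᴴ * b k := by
  have h := hb.anticomm_star k k
  rw [if_pos rfl] at h
  have h2 : b k * (b k)ᴴ = 1 - (b k)ᴴ * b k := eq_sub_of_add_eq h
  calc ((b k)ᴴ * b k) * ((b k)ᴴ * b k) = (b k)ᴴ * (b k * (b k)ᴴ) * b k := by noncomm_ring
    _ = (b k)ᴴ * b k - (b k)ᴴ * (b k)ᴴ * (b k * b k) := by rw [h2]; noncomm_ring
    _ = _ := by rw [hb.mul_self]; simp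

theorem commute_number (hb : IsCAR b) {k l : κ} (h : k ≠ l) : Commute (b k) ((b l)ᴴ * b l) := by
  have h1 : b k * (b l)ᴴ = -((b l)ᴴ * b k) := by
    have := hb.anticomm_star k l
    rw [if_neg h] at this
    exact eq_neg_of_add_eq_zero_left this
  have h2 : b k * b l = -(b l * b k) := eq_neg_of_add_eq_zero_left (hb.anticomm k l)
  rw [Commute, SemiconjBy, ← mul_assoc, h1, neg_mul, mul_assoc, h2, mul_neg, neg_neg, mul_assoc]

theorem commute_star_number (hb : IsCAR b) {k l : κ} (h : k ≠ l) :
    Commute (b k)ᴴ ((b l)ᴴ * b l) := by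
  have := congrArg conjTranspose (hb.commute_number h).eq
  simp only [conjTranspose_mul, conjTranspose_conjTranspose] at this
  exact this.symm

theorem commute_number_number (hb : IsCAR b) (k l : κ) :
    Commute ((b k)ᴴ * b k) ((b l)ᴴ * b l) := by
  by_cases h : k = l
  · subst h; exact Commute.refl _
  · exact (hb.commute_star_number h).mul_left (hb.commute_number h)

/-- An operator commuting with one mode is equally weighted on its empty and occupied parts. -/
theorem trace_number_mul (hb : IsCAR b) (k : κ) {X : Matrix m m ℂ} 
    (h2 : Commute (b k)ᴴ X) : trace ((b k)ᴴ * b k * X) = trace X / 2 := by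
  have h := hb.anticomm_star k k
  rw [if_pos rfl] at h
  -- Cyclicity carries `(b k)ᴴ` around the trace, so the occupied and empty parts have equal traces,
  -- which add up to `trace X`.
  have h3 : trace ((b k)ᴴ * b k * X) = trace (b k * (b k)ᴴ * X) := by
    rw [mul_assoc, trace_mul_comm, mul_assoc, ← h2.eq, mul_assoc]
  have h4 : trace (b k * (b k)ᴴ * X) + trace ((b k)ᴴ * b k * X) = trace X := by
    rw [← trace_add, ← add_mul, h, one_mul]
  rw [← h3] at h4
  rw [← h4]; ring

/-- Modes are peeled off one by one: `exp (w n_k) = 1 + (exp w - 1) n_k`, and `n_k` has weight one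
half against the remaining exponential. The representation need not be irreducible, so its dimension
appears as a prefactor. -/
theorem trace_exp_sum (hb : IsCAR b) (w : κ → ℂ) (S : Finset κ) :
    trace (exp (∑ k ∈ S, w k • ((b k)ᴴ * b k))) =
      Fintype.card m * ∏ k ∈ S, (1 + Complex.exp (w k)) / 2 := by
  induction S using Finset.induction_on with
  | empty => simp [trace_one]
  | insert k S hk ih =>
    have hne : ∀ l ∈ S, k ≠ l := fun l hl h => hk (h ▸ hl)
    have hc : Commute (w k • ((b k)ᴴ * b k)) (∑ l ∈ S, w l • ((b l)ᴴ * b l)) :=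
      Commute.sum_right _ _ _ fun l _ =>
        ((hb.commute_number_number k l).smul_left _).smul_right _
    have h2 : Commute (b k)ᴴ (exp (∑ l ∈ S, w l • ((b l)ᴴ * b l))) :=
      (Commute.sum_right _ _ _ fun l hl =>
        (hb.commute_star_number (hne l hl)).smul_right _).exp_right
    rw [Finset.sum_insert hk, Finset.prod_insert hk, Matrix.exp_add_of_commute _ _ hc,
      exp_smul_of_idempotent _ _ (hb.number_idempotent k), add_mul, one_mul, trace_add,
      smul_mul_assoc, trace_smul, hb.trace_number_mul k h2, ih, smul_eq_mul]
    ring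

/-- Unitary mixtures of the modes again satisfy the anticommutation relations. -/
theorem rotate [Fintype κ] (hb : IsCAR b) (U : Matrix κ κ ℂ) (hU : Uᴴ * U = 1) :
    IsCAR fun k => ∑ x, star (U x k) • b x := by
  refine ⟨fun k l => ?_, fun k l => ?_⟩
  · simp only [Finset.sum_mul, Finset.mul_sum, smul_mul_smul_comm]
    rw [Finset.sum_comm (s := Finset.univ) (t := Finset.univ) (f := fun y x =>
      (star (U x l) * star (U y k)) • (b x * b y)), ← Finset.sum_add_distrib]
    refine Finset.sum_eq_zero fun x _ => ?_
    rw [← Finset.sum_add_distrib]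
    refine Finset.sum_eq_zero fun y _ => ?_
    rw [mul_comm (star (U x l)), ← smul_add, hb.anticomm, smul_zero]
  · simp only [conjTranspose_sum, conjTranspose_smul, star_star, Finset.sum_mul, Finset.mul_sum,
      smul_mul_smul_comm]
    rw [Finset.sum_comm (s := Finset.univ) (t := Finset.univ) (f := fun x y =>
      (star (U y k) * U x l) • (b y * (b x)ᴴ)), ← Finset.sum_add_distrib]
    have h1 : ∀ x : κ, (∑ y, (star (U x k) * U y l) • (b x * (b y)ᴴ)) +
        ∑ y, (U y l * star (U x k)) • ((b y)ᴴ * b x) = ((Uᴴ) k x * U x l) • 1 := by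
      intro x
      rw [← Finset.sum_add_distrib, Finset.sum_eq_single x]
      · rw [mul_comm (U x l), ← smul_add, hb.anticomm_star, if_pos rfl]; rfl
      · intro y _ hy
        rw [mul_comm (U y l), ← smul_add, hb.anticomm_star, if_neg (Ne.symm hy), smul_zero]
      · simp
    rw [Finset.sum_congr rfl fun x _ => h1 x, ← Finset.sum_smul, ← Matrix.mul_apply, hU,
      Matrix.one_apply]
    split_ifs <;> simp

theorem quadratic_rotate [Fintype κ] (b : κ → Matrix m m ℂ) (U : Matrix κ κ ℂ) (e : κ → ℂ) :
    ∑ k, e k • ((∑ x, star (U x k) • b x)ᴴ * ∑ x, star (U x k) • b x) =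
      ∑ x, ∑ y, (U * diagonal e * Uᴴ) x y • ((b x)ᴴ * b y) := by
  simp only [conjTranspose_sum, conjTranspose_smul, star_star, Finset.sum_mul, Finset.mul_sum,
      smul_mul_smul_comm, Finset.smul_sum, smul_smul]
  have hU : ∀ x y, (U * diagonal e * Uᴴ) x y = ∑ k, U x k * e k * star (U y k) := by
    intro x y
    rw [Matrix.mul_apply]
    simp only [Matrix.mul_diagonal, Matrix.conjTranspose_apply]
  simp only [hU, Finset.sum_smul]
  rw [Finset.sum_comm]
  rw [Finset.sum_congr rfl fun x _ => Finset.sum_comm, Finset.sum_comm]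
  refine Finset.sum_congr rfl fun x _ => Finset.sum_congr rfl fun y _ =>
    Finset.sum_congr rfl fun k _ => ?_
  congr 1; ring

end IsCAR

end CAR

end LatticeGauge

namespace LatticeGauge

open Matrix NormedSpace

/-! ### Jordan–Wigner operators, second quantization and product formulas for the partition
functions. -/

section Fock

variable {L : ℕ}

/-- The Jordan–Wigner sign of the site `x` in the configuration `s`. -/
def jwSign (x : Site L) (s : Finset (Site L)) : ℂ :=
  (-1) ^ (s.filter fun y => siteIndex y < siteIndex x).card

theorem jwSign_mul_self (x : Site L) (s : Finset (Site L)) : jwSign x s * jwSign x s = 1 := by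
  rw [jwSign, ← mul_pow]; simp

theorem jwSign_insert (x y : Site L) (s : Finset (Site L)) (hy : y ∉ s) :
    jwSign x (insert y s) =
      if siteIndex y < siteIndex x then -jwSign x s else jwSign x s := by
  unfold jwSign
  rw [Finset.filter_insert]
  split_ifs with h
  · rw [Finset.card_insert_of_notMem (by simp [hy]), pow_succ]; ring
  · rfl

theorem jwSign_erase (x y : Site L) (s : Finset (Site L)) (hy : y ∈ s) :
    jwSign x (s.erase y) =
      if siteIndex y < siteIndex x then -jwSign x s else jwSign x s := by
  have := jwSign_insert x y (s.erase y) (Finset.notMem_erase y s)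
  rw [Finset.insert_erase hy] at this
  split_ifs with h
  · rw [if_pos h] at this; rw [this, neg_neg]
  · rw [if_neg h] at this; rw [this]

theorem jwSign_insert_self (x : Site L) (s : Finset (Site L)) (hx : x ∉ s) :
    jwSign x (insert x s) = jwSign x s := by
  rw [jwSign_insert x x s hx, if_neg (lt_irrefl _)]

theorem jwSign_erase_self (x : Site L) (s : Finset (Site L)) (hx : x ∈ s) :
    jwSign x (s.erase x) = jwSign x s := by
  rw [jwSign_erase x x s hx, if_neg (lt_irrefl _)]

/-- The gauge covariant shift `(T_μ f)(x) = σ_{x,μ} f(x + e_μ)`. -/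
def shift (σ : GaugeField L) (μ : Fin 2) : Matrix (Site L) (Site L) ℂ := fun x y =>
  if y = x + basisVec μ then (((σ x μ : ℤˣ) : ℤ) : ℂ) else 0

/-- The one-particle Hamiltonian. -/
noncomputable def oneParticle (t : ℝ) (σ : GaugeField L) : Matrix (Site L) (Site L) ℂ :=
  -(t : ℂ) • ∑ μ : Fin 2, (shift σ μ + (shift σ μ)ᴴ)

theorem isHermitian_oneParticle (t : ℝ) (σ : GaugeField L) : (oneParticle t σ).IsHermitian := by
  unfold oneParticle
  rw [IsHermitian, conjTranspose_smul, conjTranspose_sum]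
  simp [add_comm]

variable [NeZero L]

theorem siteIndex_injective : Function.Injective (siteIndex : Site L → ℕ) := by
  rintro ⟨x1, x2⟩ ⟨y1, y2⟩ h
  have hx := ZMod.val_lt x1
  have hy := ZMod.val_lt y1
  simp only [siteIndex] at h
  have h2 : x2.val = y2.val := by
    have := congrArg (· / L) h
    simpa [Nat.add_div_of_dvd_right, Nat.div_eq_of_lt hx, Nat.div_eq_of_lt hy,
      Nat.pos_of_neZero L, Nat.mul_div_cancel] using this
  have h1 : x1.val = y1.val := by rw [h2] at h; omega
  exact Prod.ext (ZMod.val_injective L h1) (ZMod.val_injective L h2)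

theorem annihilation_mulVec (x : Site L) (ψ : Finset (Site L) → ℂ) (s : Finset (Site L)) :
    (annihilation x *ᵥ ψ) s = if x ∈ s then 0 else jwSign x s * ψ (insert x s) := by
  simp only [Matrix.mulVec, dotProduct, annihilation]
  split_ifs with hx
  · refine Finset.sum_eq_zero fun s' _ => ?_
    rw [if_neg, zero_mul]
    rintro ⟨-, h2⟩
    exact Finset.notMem_erase x s' (h2 ▸ hx)
  · rw [Finset.sum_eq_single (insert x s)]
    · rw [if_pos ⟨Finset.mem_insert_self _ _, (Finset.erase_insert hx).symm⟩]
      have := jwSign_insert_self x s hx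
      unfold jwSign at this ⊢
      rw [this]
    · intro s' _ hs'
      rw [if_neg, zero_mul]
      rintro ⟨h1, h2⟩
      exact hs' (by rw [h2, Finset.insert_erase h1])
    · simp

theorem creation_mulVec (x : Site L) (ψ : Finset (Site L) → ℂ) (s : Finset (Site L)) :
    ((annihilation x)ᴴ *ᵥ ψ) s = if x ∈ s then jwSign x s * ψ (s.erase x) else 0 := by
  simp only [Matrix.mulVec, dotProduct, annihilation, conjTranspose_apply]
  split_ifs with hx
  · rw [Finset.sum_eq_single (s.erase x)]
    · rw [if_pos ⟨hx, rfl⟩]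
      simp [jwSign]
    · intro s' _ hs'
      rw [if_neg, star_zero, zero_mul]
      rintro ⟨-, h2⟩
      exact hs' h2
    · simp
  · refine Finset.sum_eq_zero fun s' _ => ?_
    rw [if_neg, star_zero, zero_mul]
    exact fun h => hx h.1

theorem ext_mulVec {F : Type*} [Fintype F] [DecidableEq F] {M N : Matrix F F ℂ}
    (h : ∀ ψ s, (M *ᵥ ψ) s = (N *ᵥ ψ) s) : M = N :=
  Matrix.ext_of_mulVec_single fun _ => funext fun s => h _ s

/-- For `x ≠ y` exactly one site precedes the other in `siteIndex`, so exactly one of the two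
operator orders picks up an extra Jordan–Wigner sign. -/
theorem isCAR_annihilation : IsCAR (annihilation : Site L → FockOp L) := by
  refine ⟨fun x y => ext_mulVec fun ψ s => ?_, fun x y => ext_mulVec fun ψ s => ?_⟩
  · simp only [add_mulVec, ← mulVec_mulVec, Pi.add_apply, annihilation_mulVec, zero_mulVec,
      Pi.zero_apply, Finset.mem_insert]
    by_cases hx : x ∈ s
    · simp [hx]
    by_cases hy : y ∈ s
    · simp [hy]
    by_cases hxy : x = y
    · simp [hxy]
    have h1 : siteIndex x ≠ siteIndex y := fun h => hxy (siteIndex_injective h)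
    simp only [hx, hy, hxy, Ne.symm hxy, or_self, if_false, jwSign_insert, not_false_eq_true,
      Finset.insert_comm y x]
    rcases lt_or_gt_of_ne h1 with h | h
    · rw [if_neg h.not_gt, if_pos h]; ring
    · rw [if_pos h, if_neg h.not_gt]; ring
  · by_cases hxy : x = y
    · subst hxy
      simp only [add_mulVec, ← mulVec_mulVec, Pi.add_apply, annihilation_mulVec, creation_mulVec,
        if_true, one_mulVec]
      by_cases hx : x ∈ s
      · simp only [hx, if_true, Finset.notMem_erase, if_false, zero_add, jwSign_erase_self,
          Finset.insert_erase]
        rw [← mul_assoc, jwSign_mul_self, one_mul]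
      · simp only [hx, if_false, Finset.mem_insert_self, if_true, Finset.erase_insert,
          not_false_eq_true, jwSign_insert_self, add_zero]
        rw [← mul_assoc, jwSign_mul_self, one_mul]
    · simp only [add_mulVec, ← mulVec_mulVec, Pi.add_apply, annihilation_mulVec, creation_mulVec,
        if_neg hxy, zero_mulVec, Pi.zero_apply]
      have h1 : siteIndex x ≠ siteIndex y := fun h => hxy (siteIndex_injective h)
      by_cases hx : x ∈ s
      · simp [hx, hxy]
      by_cases hy : y ∈ s
      · simp only [hx, hy, Ne.symm hxy, if_true, if_false, Finset.mem_insert, Finset.mem_erase,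
          or_true, and_false, jwSign_insert _ _ _ hx, jwSign_erase _ _ _ hy,
          Finset.erase_insert_of_ne hxy]
        rcases lt_or_gt_of_ne h1 with h | h
        · rw [if_neg h.not_gt, if_pos h]; ring
        · rw [if_pos h, if_neg h.not_gt]; ring
      · simp [hy, Ne.symm hxy]

theorem card_fock : (Fintype.card (Finset (Site L)) : ℂ) = ∏ _x : Site L, 2 := by
  rw [Fintype.card_finset, Finset.prod_const, Finset.card_univ]; push_cast; rfl

theorem sum_number_eq_diagonal :
    ∑ x : Site L, (annihilation x)ᴴ * annihilation x =
      diagonal fun s : Finset (Site L) => (s.card : ℂ) := by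
  refine ext_mulVec fun ψ s => ?_
  rw [Matrix.sum_mulVec, Finset.sum_apply, mulVec_diagonal]
  have : ∀ x : Site L, (((annihilation x)ᴴ * annihilation x) *ᵥ ψ) s =
      if x ∈ s then ψ s else 0 := by
    intro x
    rw [← mulVec_mulVec, creation_mulVec]
    split_ifs with hx
    · rw [annihilation_mulVec, if_neg (Finset.notMem_erase x s), jwSign_erase_self x s hx,
        Finset.insert_erase hx, ← mul_assoc, jwSign_mul_self, one_mul]
    · rfl
  simp [this]

/-- In this form the parity merges with the Boltzmann weight into one quadratic exponential, and
`exp (iπ) = -1` becomes the sign `ε` in each factor. -/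
theorem parity_eq_exp :
    (parity : FockOp L) =
      exp (((Real.pi : ℂ) * Complex.I) • ∑ x : Site L, (annihilation x)ᴴ * annihilation x) := by
  rw [sum_number_eq_diagonal, ← diagonal_smul, exp_diagonal, parity]
  congr 1
  funext s
  rw [Pi.coe_exp, ← Complex.exp_eq_exp_ℂ, Pi.smul_apply, smul_eq_mul, mul_comm,
    Complex.exp_nat_mul, Complex.exp_pi_mul_I]

/-- The second quantization of a one-particle operator. -/
def secondQuantization (h : Matrix (Site L) (Site L) ℂ) : FockOp L :=
  ∑ x, ∑ y, h x y • ((annihilation x)ᴴ * annihilation y)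

/-- A quadratic Hamiltonian is a combination of commuting mode numbers. -/
theorem exists_modes {h : Matrix (Site L) (Site L) ℂ} (hh : h.IsHermitian) :
    ∃ b : Site L → FockOp L, IsCAR b ∧
      secondQuantization h = ∑ k, (hh.eigenvalues k : ℂ) • ((b k)ᴴ * b k) ∧
      ∑ x : Site L, (annihilation x)ᴴ * annihilation x = ∑ k, (1 : ℂ) • ((b k)ᴴ * b k) := by
  have hspec := hh.spectral_theorem
  have hU1 : (hh.eigenvectorUnitary.1)ᴴ * hh.eigenvectorUnitary.1 = 1 :=
    mem_unitaryGroup_iff'.mp hh.eigenvectorUnitary.2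
  have hU2 : hh.eigenvectorUnitary.1 * (hh.eigenvectorUnitary.1)ᴴ = 1 :=
    mem_unitaryGroup_iff.mp hh.eigenvectorUnitary.2
  set U : Matrix (Site L) (Site L) ℂ := hh.eigenvectorUnitary.1
  replace hspec : h = U * diagonal (fun k => (hh.eigenvalues k : ℂ)) * Uᴴ := hspec
  refine ⟨_, (isCAR_annihilation (L := L)).rotate U hU1, ?_, ?_⟩
  · rw [IsCAR.quadratic_rotate, ← hspec]; rfl
  · rw [IsCAR.quadratic_rotate, diagonal_one, mul_one, hU2]
    simp [Matrix.one_apply]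

theorem commute_secondQuantization {h : Matrix (Site L) (Site L) ℂ} (hh : h.IsHermitian) :
    Commute (∑ x : Site L, (annihilation x)ᴴ * annihilation x) (secondQuantization h) := by
  obtain ⟨b, hb, h1, h2⟩ := exists_modes hh
  rw [h1, h2]
  exact Commute.sum_left _ _ _ fun k _ => Commute.sum_right _ _ _ fun l _ =>
    ((hb.commute_number_number k l).smul_left _).smul_right _

theorem trace_exp_secondQuantization {h : Matrix (Site L) (Site L) ℂ} (hh : h.IsHermitian)
    (β : ℝ) (w : ℂ) :
    trace (exp (-(β : ℂ) • secondQuantization h +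
        w • ∑ x : Site L, (annihilation x)ᴴ * annihilation x)) =
      ∏ k, (1 + Complex.exp w * Real.exp (-β * hh.eigenvalues k)) := by
  obtain ⟨b, hb, h1, h2⟩ := exists_modes hh
  rw [h1, h2, Finset.smul_sum, Finset.smul_sum, ← Finset.sum_add_distrib]
  simp only [smul_smul, ← add_smul]
  -- The Fock dimension supplies a factor 2 per mode, cancelling the halves.
  rw [hb.trace_exp_sum, card_fock, ← Finset.prod_mul_distrib]
  refine Finset.prod_congr rfl fun k _ => ?_
  rw [mul_div_cancel₀ _ two_ne_zero, mul_one, Complex.exp_add, Complex.ofReal_exp]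
  push_cast
  ring

theorem secondQuantization_add (M N : Matrix (Site L) (Site L) ℂ) :
    secondQuantization (M + N) = secondQuantization M + secondQuantization N := by
  simp only [secondQuantization, Matrix.add_apply, add_smul, Finset.sum_add_distrib]

theorem secondQuantization_smul (c : ℂ) (M : Matrix (Site L) (Site L) ℂ) :
    secondQuantization (c • M) = c • secondQuantization M := by
  simp only [secondQuantization, Matrix.smul_apply, smul_assoc, Finset.smul_sum]

theorem secondQuantization_conjTranspose (M : Matrix (Site L) (Site L) ℂ) :
    secondQuantization Mᴴ = (secondQuantization M)ᴴ := by
  simp only [secondQuantization, conjTranspose_sum, conjTranspose_smul, conjTranspose_mul,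
    conjTranspose_conjTranspose, conjTranspose_apply]
  rw [Finset.sum_comm]

theorem secondQuantization_shift (σ : GaugeField L) (μ : Fin 2) :
    secondQuantization (shift σ μ) = ∑ x, hopping σ x μ := by
  refine Finset.sum_congr rfl fun x _ => ?_
  simp [shift, hopping, creation]

theorem matterHamiltonian_eq (t : ℝ) (σ : GaugeField L) :
    matterHamiltonian t σ = secondQuantization (oneParticle t σ) := by
  rw [oneParticle, secondQuantization_smul, Fin.sum_univ_two]
  simp only [secondQuantization_add, secondQuantization_conjTranspose, secondQuantization_shift,
    matterHamiltonian, Fin.sum_univ_two, conjTranspose_sum, Finset.sum_add_distrib]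
  congr 1
  abel

theorem hamiltonian_eq (t : ℝ) (σ : GaugeField L) (hσ : ∀ x, plaquette σ x = -1) :
    hamiltonian t σ = ((L : ℂ) ^ 2) • (1 : FockOp L) + secondQuantization (oneParticle t σ) := by
  rw [hamiltonian, matterHamiltonian_eq]
  simp [hσ, Finset.card_univ, ZMod.card, sq]

theorem exp_hamiltonian (t β : ℝ) (σ : GaugeField L) (hσ : ∀ x, plaquette σ x = -1) :
    exp (-(β : ℂ) • hamiltonian t σ) = Complex.exp (-β * (L : ℂ) ^ 2) •
      exp (-(β : ℂ) • secondQuantization (oneParticle t σ)) := by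
  rw [hamiltonian_eq t σ hσ, smul_add, smul_smul, Matrix.exp_add_of_commute,
    exp_smul_of_idempotent _ _ (one_mul 1), sub_smul, one_smul, add_sub_cancel, smul_mul_assoc,
    one_mul]
  exact (Commute.one_left _).smul_left _

theorem partitionFn_eq (ε : ℤˣ) (t β : ℝ) (σ : GaugeField L) (hσ : ∀ x, plaquette σ x = -1) :
    partitionFn ε t β σ = ((Real.exp (-β * (L : ℝ) ^ 2) * ∏ k,
      (1 + ((ε : ℤ) : ℝ) * Real.exp (-β * (isHermitian_oneParticle t σ).eigenvalues k)) : ℝ) : ℂ) := by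
  have hh := isHermitian_oneParticle t σ
  rcases Int.units_eq_one_or ε with rfl | rfl
  · rw [partitionFn, if_pos rfl, evenPartition, exp_hamiltonian t β σ hσ, trace_smul]
    have := trace_exp_secondQuantization hh β 0
    rw [zero_smul, add_zero] at this
    rw [this]
    simp
  · rw [partitionFn, if_neg (by decide), oddPartition, exp_hamiltonian t β σ hσ, mul_smul_comm,
      trace_smul, parity_eq_exp, trace_mul_comm, ← Matrix.exp_add_of_commute,
      trace_exp_secondQuantization hh, Complex.exp_pi_mul_I]
    · simp
    · exact ((commute_secondQuantization hh).symm.smul_left _).smul_right _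

end Fock

end LatticeGauge

namespace LatticeGauge

open Matrix NormedSpace

/-! ### The spectrum of the one-particle Hamiltonian -/

/-- Two finite weighted families of reals with the same power sums have the same sums under every
function. -/
theorem sum_comp_eq_of_sum_pow_eq {ι κ : Type*} [Fintype ι] [Fintype κ] (u : ι → ℝ) (v : κ → ℝ)
    (c : ℝ) (h : ∀ n : ℕ, ∑ i, u i ^ n = c * ∑ j, v j ^ n) (g : ℝ → ℝ) :
    ∑ i, g (u i) = c * ∑ j, g (v j) := by
  classical
  have hpoly : ∀ q : Polynomial ℝ, ∑ i, q.eval (u i) = c * ∑ j, q.eval (v j) := by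
    intro q
    simp only [Polynomial.eval_eq_sum_range]
    rw [Finset.sum_comm, Finset.sum_comm (s := (Finset.univ : Finset κ)), Finset.mul_sum]
    refine Finset.sum_congr rfl fun n _ => ?_
    rw [← Finset.mul_sum, ← Finset.mul_sum, h]; ring
  -- Only finitely many values of `g` enter, so `g` can be replaced by an interpolating polynomial.
  set s : Finset ℝ := Finset.univ.image u ∪ Finset.univ.image v
  set q := Lagrange.interpolate s id g
  have hq : ∀ x ∈ s, q.eval x = g x := fun x hx =>
    Lagrange.eval_interpolate_at_node (v := id) g (Set.injOn_id _) hx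
  have := hpoly q
  rwa [Finset.sum_congr rfl fun i _ => hq (u i) (by simp [s]),
    Finset.sum_congr rfl fun j _ => hq (v j) (by simp [s])] at this

theorem _root_.Matrix.IsHermitian.trace_pow_eq_sum {n : Type*} [Fintype n] [DecidableEq n]
    {A : Matrix n n ℂ} (hA : A.IsHermitian) (k : ℕ) :
    trace (A ^ k) = ((∑ i, hA.eigenvalues i ^ k : ℝ) : ℂ) := by
  conv_lhs => rw [hA.spectral_theorem, ← map_pow, diagonal_pow]
  rw [Unitary.conjStarAlgAut_apply, trace_mul_cycle]
  simp [trace_diagonal]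

/-! ### Algebra of the gauge covariant shifts. -/

section Shift

variable {L : ℕ}

theorem shift_mul_apply [NeZero L] (σ : GaugeField L) (μ : Fin 2) (M : Matrix (Site L) (Site L) ℂ)
    (x y : Site L) :
    (shift σ μ * M) x y = (((σ x μ : ℤˣ) : ℤ) : ℂ) * M (x + basisVec μ) y := by
  simp [Matrix.mul_apply, shift]

theorem unit_mul_self (u : ℤˣ) : (((u : ℤˣ) : ℤ) : ℂ) * ((u : ℤˣ) : ℤ) = 1 := by
  rcases Int.units_eq_one_or u with rfl | rfl <;> simp

theorem shift_mul_conjTranspose [NeZero L] (σ : GaugeField L) (μ : Fin 2) :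
    shift σ μ * (shift σ μ)ᴴ = 1 := by
  ext x y
  rw [shift_mul_apply, conjTranspose_apply, shift, Matrix.one_apply]
  by_cases h : x = y
  · subst h
    simp [unit_mul_self]
  · rw [if_neg h, if_neg (by simpa using h)]; simp

theorem conjTranspose_mul_shift [NeZero L] (σ : GaugeField L) (μ : Fin 2) :
    (shift σ μ)ᴴ * shift σ μ = 1 :=
  mul_eq_one_comm.mp (shift_mul_conjTranspose σ μ)

/-- The two paths from `x` to the opposite corner together bound one plaquette, so their signs
differ by its flux `-1`. -/
theorem shift_anticomm [NeZero L] (σ : GaugeField L) (hσ : ∀ x, plaquette σ x = -1) :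
    shift σ 0 * shift σ 1 = -(shift σ 1 * shift σ 0) := by
  ext x y
  rw [Matrix.neg_apply, shift_mul_apply, shift_mul_apply]
  simp only [shift, add_right_comm x (basisVec 1) (basisVec 0)]
  by_cases h : y = x + basisVec 0 + basisVec 1
  · rw [if_pos h, if_pos h]
    have h1 := hσ x
    unfold plaquette at h1
    have h2 : σ x 0 * σ (x + basisVec 0) 1 = -(σ x 1 * σ (x + basisVec 1) 0) := by
      have h3 := congrArg (· * (σ x 1 * σ (x + basisVec 1) 0)) h1
      have e1 := Int.units_mul_self (σ x 1)
      have e2 := Int.units_mul_self (σ (x + basisVec 1) 0)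
      calc σ x 0 * σ (x + basisVec 0) 1 = σ x 0 * σ (x + basisVec 0) 1 *
            (σ (x + basisVec 1) 0 * σ (x + basisVec 1) 0) * (σ x 1 * σ x 1) := by simp
        _ = (σ x 0 * σ (x + basisVec 0) 1 * σ (x + basisVec 1) 0 * σ x 1) *
            (σ x 1 * σ (x + basisVec 1) 0) := by
          simp only [mul_assoc, mul_comm, mul_left_comm]
        _ = _ := by rw [h1]; simp
    have h4 := congrArg (fun u : ℤˣ => ((u : ℤ) : ℂ)) h2
    simpa using h4
  · rw [if_neg h, if_neg h]; simp

theorem shift_pow_apply [NeZero L] (σ : GaugeField L) (μ : Fin 2) (n : ℕ) (x y : Site L) :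
    (shift σ μ ^ n) x y = if y = x + n • basisVec μ then
      (((∏ i ∈ Finset.range n, σ (x + i • basisVec μ) μ : ℤˣ) : ℤ) : ℂ) else 0 := by
  induction n generalizing x with
  | zero => simp [Matrix.one_apply, eq_comm]
  | succ n ih =>
    rw [pow_succ', shift_mul_apply, ih, Finset.prod_range_succ', add_assoc, ← succ_nsmul']
    split_ifs
    · have : ∀ i : ℕ, x + basisVec μ + i • basisVec μ = x + (i + 1) • basisVec μ := by
        intro i; rw [add_assoc, ← succ_nsmul']
      simp only [this, zero_nsmul, add_zero]
      push_cast
      ring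
    · simp

theorem nsmul_basisVec_zero (n : ℕ) : n • (basisVec 0 : Site L) = ((n : ZMod L), 0) := by
  simp [basisVec]

theorem nsmul_basisVec_one (n : ℕ) : n • (basisVec 1 : Site L) = (0, (n : ZMod L)) := by
  simp [basisVec]

theorem nsmul_basisVec_self (μ : Fin 2) : L • (basisVec μ : Site L) = 0 := by
  rcases Fin.exists_fin_two.mp ⟨μ, rfl⟩ with rfl | rfl
  · rw [nsmul_basisVec_zero, ZMod.natCast_self]; rfl
  · rw [nsmul_basisVec_one, ZMod.natCast_self]; rfl

theorem prod_range_eq_prod_zmod [NeZero L] {M : Type*} [CommMonoid M] (f : ZMod L → M) :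
    ∏ i ∈ Finset.range L, f i = ∏ i : ZMod L, f i := by
  refine Finset.prod_bij' (fun i _ => (i : ZMod L)) (fun j _ => j.val) (by simp)
    (fun j _ => by simpa using ZMod.val_lt j) (fun i hi => ?_) (by simp) (by simp)
  exact ZMod.val_cast_of_lt (Finset.mem_range.mp hi)

/-- A diagonal matrix commuting with both shifts is scalar. -/
theorem scalar_of_commute [NeZero L] (σ : GaugeField L) (d : Site L → ℂ)
    (h : ∀ μ, Commute (shift σ μ) (diagonal d)) : diagonal d = d 0 • 1 := by
  have h1 : ∀ μ x, d (x + basisVec μ) = d x := by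
    intro μ x
    have := congrFun (congrFun (h μ).eq x) (x + basisVec μ)
    rw [mul_diagonal, diagonal_mul, mul_comm] at this
    have h2 : shift σ μ x (x + basisVec μ) ≠ 0 := by
      rw [shift, if_pos rfl]
      exact left_ne_zero_of_mul_eq_one (unit_mul_self _)
    exact mul_right_cancel₀ h2 this
  have h2 : ∀ μ (n : ℕ) x, d (x + n • basisVec μ) = d x := by
    intro μ n x
    induction n with
    | zero => simp
    | succ n ih => rw [succ_nsmul, ← add_assoc, h1, ih]
  have h3 : ∀ x, d x = d 0 := by
    intro x
    rw [← h2 1 x.2.val 0, ← h2 0 x.1.val (0 + _), nsmul_basisVec_zero, nsmul_basisVec_one, zero_add]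
    simp
  rw [← diagonal_one, ← diagonal_smul]
  congr 1
  funext x
  simp [h3 x]

theorem shift_pow_commute [NeZero L] (σ : GaugeField L) (hσ : ∀ x, plaquette σ x = -1)
    {n : ℕ} (hn : Even n) (μ ν : Fin 2) : Commute (shift σ μ) (shift σ ν ^ n) := by
  have h1 : ∀ μ ν, Commute (shift σ μ) (shift σ ν ^ 2) := by
    have h := shift_anticomm σ hσ
    intro μ ν
    rcases Fin.exists_fin_two.mp ⟨μ, rfl⟩ with rfl | rfl <;>
    rcases Fin.exists_fin_two.mp ⟨ν, rfl⟩ with rfl | rfl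
    · exact (Commute.refl _).pow_right _
    · rw [Commute, SemiconjBy, sq, ← mul_assoc, h, neg_mul, mul_assoc, h, mul_neg, neg_neg,
        mul_assoc]
    · have h' : shift σ 1 * shift σ 0 = -(shift σ 0 * shift σ 1) := by rw [h, neg_neg]
      rw [Commute, SemiconjBy, sq, ← mul_assoc, h', neg_mul, mul_assoc, h', mul_neg, neg_neg,
        mul_assoc]
    · exact (Commute.refl _).pow_right _
  obtain ⟨m, rfl⟩ := hn.two_dvd
  rw [pow_mul]
  exact (h1 μ ν).pow_right m

/-- The power is diagonal, with entry at `x` the holonomy of the circle through `x`. For even `L` it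
commutes with both shifts, so it is constant and can be read off at the origin, on the circles fixed
by `IsPiFlux`. -/
theorem shift_pow_card [NeZero L] (hL : Even L) {σ : GaugeField L} {a b : ℤˣ}
    (hσ : IsPiFlux σ a b) (μ : Fin 2) :
    shift σ μ ^ L = ((((if μ = 0 then a else b : ℤˣ) : ℤ) : ℂ)) • 1 := by
  have hd : shift σ μ ^ L = diagonal fun x =>
      (((∏ i ∈ Finset.range L, σ (x + i • basisVec μ) μ : ℤˣ) : ℤ) : ℂ) := by
    ext x y
    rw [shift_pow_apply, nsmul_basisVec_self, add_zero, diagonal_apply]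
    simp only [eq_comm]
  rw [hd, scalar_of_commute σ _ fun ν => hd ▸ shift_pow_commute σ hσ.plaquette_eq hL ν μ]
  congr 3
  rcases Fin.exists_fin_two.mp ⟨μ, rfl⟩ with rfl | rfl
  · rw [if_pos rfl, ← hσ.horizontal_eq, ← prod_range_eq_prod_zmod]
    simp only [nsmul_basisVec_zero, zero_add]
  · rw [if_neg (by decide), ← hσ.vertical_eq, ← prod_range_eq_prod_zmod]
    simp only [nsmul_basisVec_one, zero_add]

end Shift

end LatticeGauge

namespace LatticeGauge

open Matrix NormedSpace

/-! ### Bloch sums as unnormalized spectral projections. -/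

section Bloch

variable {m : Type*} [Fintype m] [DecidableEq m]

/-- The unnormalized projection onto the eigenspace of `U` for the eigenvalue `z`, when
`U ^ ℓ = z ^ ℓ`. -/
noncomputable def blochSum (ℓ : ℕ) (U : Matrix m m ℂ) (z : ℂ) : Matrix m m ℂ :=
  ∑ n ∈ Finset.range ℓ, (z⁻¹) ^ n • U ^ n

/-- Multiplication by `U` shifts the geometric sum by one place, and the new term at `n = ℓ` equals
the lost term at `n = 0`. -/
theorem mul_blochSum {ℓ : ℕ} {U : Matrix m m ℂ} {z : ℂ} (hz : z ≠ 0) (hU : U ^ ℓ = z ^ ℓ • 1) :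
    U * blochSum ℓ U z = z • blochSum ℓ U z := by
  have h1 : U * blochSum ℓ U z =
      z • ∑ n ∈ Finset.range ℓ, (z⁻¹) ^ (n + 1) • U ^ (n + 1) := by
    rw [blochSum, Finset.mul_sum, Finset.smul_sum]
    refine Finset.sum_congr rfl fun n _ => ?_
    rw [mul_smul_comm, smul_smul, ← pow_succ', pow_succ' z⁻¹, mul_inv_cancel_left₀ hz]
  have h2 := Finset.sum_range_succ (fun n => (z⁻¹) ^ n • U ^ n) ℓ
  rw [Finset.sum_range_succ', hU, smul_smul, ← mul_pow, inv_mul_cancel₀ hz] at h2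
  simp only [one_pow, pow_zero, one_smul, add_left_inj] at h2
  rw [h1, h2]; rfl

theorem commute_blochSum {ℓ : ℕ} {U V : Matrix m m ℂ} (h : Commute V U) (z : ℂ) :
    Commute V (blochSum ℓ U z) :=
  Commute.sum_right _ _ _ fun n _ => (h.pow_right n).smul_right _

/-- The `ℓ`-th roots `-e^{2πi(j+θ)/ℓ}` of `(-1)^ℓ e^{2πiθ}`. -/
noncomputable def blochRoot (ℓ : ℕ) (θ : ℝ) (j : ℕ) : ℂ :=
  -Complex.exp (((2 * (Real.pi * (j + θ) / ℓ) : ℝ) : ℂ) * Complex.I)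

theorem blochRoot_ne_zero (ℓ : ℕ) (θ : ℝ) (j : ℕ) : blochRoot ℓ θ j ≠ 0 :=
  neg_ne_zero.mpr (Complex.exp_ne_zero _)

theorem blochRoot_pow {ℓ : ℕ} (hℓ : ℓ ≠ 0) (θ : ℝ) (j : ℕ) :
    blochRoot ℓ θ j ^ ℓ = (-1) ^ ℓ * Complex.exp (2 * Real.pi * θ * Complex.I) := by
  have hℓ' : (ℓ : ℂ) ≠ 0 := Nat.cast_ne_zero.mpr hℓ
  rw [blochRoot, neg_pow, ← Complex.exp_nat_mul]
  congr 1
  rw [show ((ℓ : ℂ) * (((2 * (Real.pi * (j + θ) / ℓ) : ℝ) : ℂ) * Complex.I)) =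
    2 * Real.pi * θ * Complex.I + j * (2 * Real.pi * Complex.I) by push_cast; field_simp; ring]
  exact Complex.exp_periodic.nat_mul j _

/-- The minus sign in `blochRoot` turns `2 + 2cos` into `4 sin²`, placing the zero of the dispersion
at `j + θ = 0`. -/
theorem blochRoot_add_inv (ℓ : ℕ) (θ : ℝ) (j : ℕ) :
    2 + blochRoot ℓ θ j + (blochRoot ℓ θ j)⁻¹ =
      ((4 * Real.sin (Real.pi * (j + θ) / ℓ) ^ 2 : ℝ) : ℂ) := by
  rw [blochRoot, inv_neg, ← Complex.exp_neg]
  set x := Real.pi * (j + θ) / ℓ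
  have h := Complex.two_cos ((2 * x : ℝ) : ℂ)
  rw [neg_mul] at h
  have h2 : Real.sin x ^ 2 = 1 / 2 - Real.cos (2 * x) / 2 := Real.sin_sq_eq_half_sub x
  rw [h2]
  push_cast at h ⊢
  linear_combination h

theorem sum_blochRoot_inv_pow {ℓ n : ℕ} (hn : n < ℓ) (θ : ℝ) :
    ∑ j ∈ Finset.range ℓ, (blochRoot ℓ θ j)⁻¹ ^ n = if n = 0 then (ℓ : ℂ) else 0 := by
  split_ifs with h0
  · subst h0; simp
  have hℓ : ℓ ≠ 0 := by omega
  have hℓ' : (ℓ : ℂ) ≠ 0 := Nat.cast_ne_zero.mpr hℓ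
  set ζ := Complex.exp (2 * Real.pi * Complex.I / ℓ)
  have hζ : IsPrimitiveRoot ζ ℓ := Complex.isPrimitiveRoot_exp ℓ hℓ
  have h1 : ∀ j, blochRoot ℓ θ j = blochRoot ℓ θ 0 * ζ ^ j := by
    intro j
    rw [blochRoot, blochRoot, neg_mul, ← Complex.exp_nat_mul, ← Complex.exp_add]
    congr 2
    push_cast
    field_simp
    ring
  set ω := (ζ⁻¹) ^ n
  have hω : ω ≠ 1 := (hζ.inv.pow_ne_one_of_pos_of_lt h0 hn)
  have hω' : ω ^ ℓ = 1 := by rw [← pow_mul, mul_comm, pow_mul, hζ.inv.pow_eq_one, one_pow]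
  have h2 : ∀ j, (blochRoot ℓ θ j)⁻¹ ^ n = (blochRoot ℓ θ 0)⁻¹ ^ n * ω ^ j := by
    intro j
    rw [h1 j, mul_inv, mul_pow, ← inv_pow, ← pow_mul, ← pow_mul, mul_comm j n]
  rw [Finset.sum_congr rfl fun j _ => h2 j, ← Finset.mul_sum, geom_sum_eq hω, hω', sub_self, zero_div, mul_zero]

/-- Completeness of the projections: orthogonality of characters kills every power of `U` except the
zeroth. -/
theorem sum_blochSum {ℓ : ℕ} (hℓ : ℓ ≠ 0) (U : Matrix m m ℂ) (θ : ℝ) :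
    ∑ j ∈ Finset.range ℓ, blochSum ℓ U (blochRoot ℓ θ j) = (ℓ : ℂ) • 1 := by
  simp only [blochSum]
  rw [Finset.sum_comm]
  simp only [← Finset.sum_smul]
  rw [Finset.sum_congr rfl fun n hn => by rw [sum_blochRoot_inv_pow (Finset.mem_range.mp hn)]]
  rw [Finset.sum_eq_single_of_mem 0 (Finset.mem_range.mpr (Nat.pos_of_ne_zero hℓ))]
  · simp
  · intro n _ hn; simp [hn]

end Bloch

/-! ### Squared energies in momentum space and symmetry of the spectrum. -/

section Spectrum

variable {ℓ : ℕ} [NeZero ℓ]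

/-- The product translates by `(2p, 2q)` with both entries below `2ℓ`, so it has no diagonal entries
unless `p = q = 0`. This forces equal multiplicity for all momenta. -/
theorem trace_shift_pow_mul (σ : GaugeField (2 * ℓ)) {p q : ℕ} (hp : p < ℓ) (hq : q < ℓ) :
    trace ((shift σ 0 ^ 2) ^ p * (shift σ 1 ^ 2) ^ q) =
      if p = 0 ∧ q = 0 then 4 * (ℓ : ℂ) ^ 2 else 0 := by
  split_ifs with h
  · obtain ⟨rfl, rfl⟩ := h
    simp [trace_one, Fintype.card_prod, ZMod.card]
    ring
  · refine Finset.sum_eq_zero fun x _ => ?_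
    rw [diag_apply, ← pow_mul, ← pow_mul, Matrix.mul_apply]
    refine Finset.sum_eq_zero fun y _ => ?_
    rw [shift_pow_apply, shift_pow_apply]
    split_ifs with h1 h2
    · exfalso
      rw [h1, add_assoc, left_eq_add, nsmul_basisVec_zero, nsmul_basisVec_one, Prod.mk_add_mk,
        add_zero, zero_add, Prod.mk_eq_zero, ZMod.natCast_eq_zero_iff,
        ZMod.natCast_eq_zero_iff] at h2
      have h3 := Nat.eq_zero_of_dvd_of_lt h2.1 (by omega)
      have h4 := Nat.eq_zero_of_dvd_of_lt h2.2 (by omega)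
      omega
    all_goals simp

/-- The momentum shift selected by the boundary flux `a`. -/
noncomputable def fluxShift (ℓ : ℕ) (a : ℤˣ) : ℝ := if a = refFlux ℓ then 0 else 1 / 2

/-- The sign `(-1)^ℓ` produced by the minus in `blochRoot` is `refFlux ℓ`, and a half-step shift
flips it. This is where the parity of `ℓ` enters. -/
theorem blochRoot_fluxShift_pow (a : ℤˣ) (j : ℕ) :
    blochRoot ℓ (fluxShift ℓ a) j ^ ℓ = ((a : ℤ) : ℂ) := by
  rw [blochRoot_pow (NeZero.ne ℓ), fluxShift, refFlux]
  rcases Nat.even_or_odd ℓ with h | h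
  · rw [if_pos h, h.neg_one_pow]
    rcases Int.units_eq_one_or a with rfl | rfl
    · simp
    · rw [if_neg (by decide)]
      have : (2 * (Real.pi : ℂ) * ((1 / 2 : ℝ) : ℂ) * Complex.I) = Real.pi * Complex.I := by
        push_cast; ring
      rw [this, Complex.exp_pi_mul_I]; simp
  · rw [if_neg (Nat.not_even_iff_odd.mpr h), h.neg_one_pow]
    rcases Int.units_eq_one_or a with rfl | rfl
    · rw [if_neg (by decide)]
      have : (2 * (Real.pi : ℂ) * ((1 / 2 : ℝ) : ℂ) * Complex.I) = Real.pi * Complex.I := by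
        push_cast; ring
      rw [this, Complex.exp_pi_mul_I]; simp
    · simp

/-- The squares of the one-particle energies, in units of `t`. -/
noncomputable def dispersionSq (ℓ : ℕ) (a b : ℤˣ) (j k : ℕ) : ℝ :=
  4 * (Real.sin (Real.pi * (j + fluxShift ℓ a) / ℓ) ^ 2 +
    Real.sin (Real.pi * (k + fluxShift ℓ b) / ℓ) ^ 2)

variable {σ : GaugeField (2 * ℓ)} {a b : ℤˣ}

theorem shift_anticomm_conjTranspose (hσ : ∀ x, plaquette σ x = -1) :
    shift σ 0 * (shift σ 1)ᴴ = -((shift σ 1)ᴴ * shift σ 0) := by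
  have h := shift_anticomm σ hσ
  have u1 := shift_mul_conjTranspose σ 1
  have v1 := conjTranspose_mul_shift σ 1
  set A := shift σ 0
  set B := shift σ 1
  calc A * Bᴴ = (Bᴴ * B) * A * Bᴴ := by rw [v1, one_mul]
    _ = -(Bᴴ * (A * B) * Bᴴ) := by rw [h]; noncomm_ring
    _ = -(Bᴴ * A * (B * Bᴴ)) := by noncomm_ring
    _ = _ := by rw [u1, mul_one]

/-- The anticommuting cross terms cancel and unitarity produces the 4. What remains involves only
the `T_μ²` and their adjoints, which can be diagonalized simultaneously. -/
theorem oneParticle_sq (t : ℝ) (hσ : ∀ x, plaquette σ x = -1) :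
    oneParticle t σ ^ 2 = ((t ^ 2 : ℝ) : ℂ) • (4 + (shift σ 0 ^ 2 + (shift σ 0 ^ 2)ᴴ) +
      (shift σ 1 ^ 2 + (shift σ 1 ^ 2)ᴴ)) := by
  have h := shift_anticomm σ hσ
  have u0 := shift_mul_conjTranspose σ 0
  have u1 := shift_mul_conjTranspose σ 1
  have v0 := conjTranspose_mul_shift σ 0
  have v1 := conjTranspose_mul_shift σ 1
  rw [oneParticle, smul_pow, Fin.sum_univ_two, conjTranspose_pow, conjTranspose_pow]
  set A := shift σ 0
  set B := shift σ 1
  have h1 : A * Bᴴ = -(Bᴴ * A) := shift_anticomm_conjTranspose hσ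
  have h2 : Aᴴ * B = -(B * Aᴴ) := by
    have := congrArg conjTranspose h1
    simp only [conjTranspose_neg, conjTranspose_mul, conjTranspose_conjTranspose] at this
    rw [this, neg_neg]
  have h3 : Aᴴ * Bᴴ = -(Bᴴ * Aᴴ) := by
    have := congrArg conjTranspose h
    simp only [conjTranspose_neg, conjTranspose_mul] at this
    rw [this, neg_neg]
  congr 1
  · push_cast; ring
  · have e : (A + Aᴴ + (B + Bᴴ)) ^ 2 = A ^ 2 + Aᴴ ^ 2 + B ^ 2 + Bᴴ ^ 2 + (A * Aᴴ) + (Aᴴ * A) +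
        (B * Bᴴ) + (Bᴴ * B) + (A * B + B * A) + (A * Bᴴ + Bᴴ * A) + (Aᴴ * B + B * Aᴴ) +
        (Aᴴ * Bᴴ + Bᴴ * Aᴴ) := by noncomm_ring
    rw [e, u0, u1, v0, v1, h, h1, h2, h3]
    have : (4 : Matrix (Site (2 * ℓ)) (Site (2 * ℓ)) ℂ) = 1 + 1 + 1 + 1 := by norm_num
    rw [this]
    abel

/-- No eigenbasis is needed: inserting `∑ P p = ℓ²` splits the trace into pieces on which `h²` acts
as a scalar, and `trace (P p) = 4ℓ²` gives multiplicity 4. -/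
theorem trace_oneParticle_pow (t : ℝ) (hσ : IsPiFlux σ a b) (n : ℕ) :
    trace ((oneParticle t σ ^ 2) ^ n) = 4 * ∑ p ∈ Finset.range ℓ ×ˢ Finset.range ℓ,
      ((t ^ 2 * dispersionSq ℓ a b p.1 p.2 : ℝ) : ℂ) ^ n := by
  set U := shift σ 0 ^ 2 with hU
  set V := shift σ 1 ^ 2 with hV
  have hUV : Commute V U := (shift_pow_commute σ hσ.plaquette_eq even_two 1 0).pow_left 2
  have hUu : Uᴴ * U = 1 := by
    rw [hU, conjTranspose_pow, ← (show Commute _ _ from ?_).mul_pow, conjTranspose_mul_shift,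
      one_pow]
    rw [Commute, SemiconjBy, conjTranspose_mul_shift, shift_mul_conjTranspose]
  have hVu : Vᴴ * V = 1 := by
    rw [hV, conjTranspose_pow, ← (show Commute _ _ from ?_).mul_pow, conjTranspose_mul_shift,
      one_pow]
    rw [Commute, SemiconjBy, conjTranspose_mul_shift, shift_mul_conjTranspose]
  have hUp : ∀ j, U ^ ℓ = blochRoot ℓ (fluxShift ℓ a) j ^ ℓ • 1 := by
    intro j
    rw [blochRoot_fluxShift_pow, hU, ← pow_mul, shift_pow_card (even_two_mul ℓ) hσ, if_pos rfl]
  have hVp : ∀ j, V ^ ℓ = blochRoot ℓ (fluxShift ℓ b) j ^ ℓ • 1 := by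
    intro j
    rw [blochRoot_fluxShift_pow, hV, ← pow_mul, shift_pow_card (even_two_mul ℓ) hσ,
      if_neg (by decide)]
  set P : ℕ × ℕ → Matrix (Site (2 * ℓ)) (Site (2 * ℓ)) ℂ := fun p =>
    blochSum ℓ U (blochRoot ℓ (fluxShift ℓ a) p.1) *
      blochSum ℓ V (blochRoot ℓ (fluxShift ℓ b) p.2) with hP
  have inv_act : ∀ (W X : Matrix (Site (2 * ℓ)) (Site (2 * ℓ)) ℂ) (z : ℂ), z ≠ 0 → Wᴴ * W = 1 →
      W * X = z • X → Wᴴ * X = z⁻¹ • X := by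
    intro W X z hz hW hX
    have h1 : X = z • (Wᴴ * X) := by
      rw [← mul_smul_comm, ← hX, ← mul_assoc, hW, one_mul]
    conv_rhs => rw [h1]
    rw [smul_smul, inv_mul_cancel₀ hz, one_smul]
  have hact : ∀ p, oneParticle t σ ^ 2 * P p =
      ((t ^ 2 * dispersionSq ℓ a b p.1 p.2 : ℝ) : ℂ) • P p := by
    intro p
    have hz := blochRoot_ne_zero ℓ (fluxShift ℓ a) p.1
    have hw := blochRoot_ne_zero ℓ (fluxShift ℓ b) p.2
    have e1 : U * P p = blochRoot ℓ (fluxShift ℓ a) p.1 • P p := by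
      rw [hP]; simp only
      rw [← mul_assoc, mul_blochSum hz (hUp _), smul_mul_assoc]
    have e2 : V * P p = blochRoot ℓ (fluxShift ℓ b) p.2 • P p := by
      rw [hP]; simp only
      rw [← mul_assoc, (commute_blochSum hUV _).eq, mul_assoc, mul_blochSum hw (hVp _),
        mul_smul_comm]
    have e3 := inv_act U (P p) _ hz hUu e1
    have e4 := inv_act V (P p) _ hw hVu e2
    rw [oneParticle_sq t hσ.plaquette_eq, smul_mul_assoc, add_mul, add_mul, add_mul, add_mul, e1,
      e2, e3, e4]
    have e5 : (4 : Matrix (Site (2 * ℓ)) (Site (2 * ℓ)) ℂ) * P p = (4 : ℂ) • P p := by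
      rw [← map_ofNat (algebraMap ℂ (Matrix (Site (2 * ℓ)) (Site (2 * ℓ)) ℂ)) 4,
        Algebra.algebraMap_eq_smul_one, smul_mul_assoc, one_mul]
    rw [e5, ← add_smul, ← add_smul, ← add_smul, ← add_smul, smul_smul]
    congr 1
    have b1 := blochRoot_add_inv ℓ (fluxShift ℓ a) p.1
    have b2 := blochRoot_add_inv ℓ (fluxShift ℓ b) p.2
    rw [dispersionSq]
    push_cast at b1 b2 ⊢
    linear_combination (t : ℂ) ^ 2 * b1 + (t : ℂ) ^ 2 * b2
  have hactn : ∀ p, (oneParticle t σ ^ 2) ^ n * P p =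
      ((t ^ 2 * dispersionSq ℓ a b p.1 p.2 : ℝ) : ℂ) ^ n • P p := by
    intro p
    induction n with
    | zero => simp
    | succ n ih => rw [pow_succ, mul_assoc, hact, mul_smul_comm, ih, smul_smul, ← pow_succ']
  have htr : ∀ p, trace (P p) = 4 * (ℓ : ℂ) ^ 2 := by
    intro p
    simp only [hP, blochSum]
    rw [Finset.sum_mul_sum, ← Finset.sum_product', trace_sum,
      Finset.sum_eq_single_of_mem ((0, 0) : ℕ × ℕ) (by simp [Nat.pos_of_neZero])]
    · rw [smul_mul_smul_comm, trace_smul, trace_shift_pow_mul σ (Nat.pos_of_neZero ℓ)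
        (Nat.pos_of_neZero ℓ)]
      simp
    · intro q hq hq0
      rw [Finset.mem_product, Finset.mem_range, Finset.mem_range] at hq
      rw [smul_mul_smul_comm, trace_smul, trace_shift_pow_mul σ hq.1 hq.2, if_neg, smul_zero]
      exact fun h => hq0 (Prod.ext h.1 h.2)
  have hsum : ∑ p ∈ Finset.range ℓ ×ˢ Finset.range ℓ, P p = ((ℓ : ℂ) ^ 2) • 1 := by
    rw [Finset.sum_product' (f := fun i j => P (i, j)), hP]
    simp only
    rw [← Finset.sum_mul_sum, sum_blochSum (NeZero.ne ℓ), sum_blochSum (NeZero.ne ℓ),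
      smul_mul_smul_comm, mul_one, sq]
  have hℓ : (ℓ : ℂ) ≠ 0 := Nat.cast_ne_zero.mpr (NeZero.ne ℓ)
  have hfin : (ℓ : ℂ) ^ 2 * trace ((oneParticle t σ ^ 2) ^ n) =
      ∑ p ∈ Finset.range ℓ ×ˢ Finset.range ℓ,
        ((t ^ 2 * dispersionSq ℓ a b p.1 p.2 : ℝ) : ℂ) ^ n * (4 * (ℓ : ℂ) ^ 2) := by
    rw [← smul_eq_mul, ← trace_smul, ← mul_one ((oneParticle t σ ^ 2) ^ n), ← mul_smul_comm,
      ← hsum, Finset.mul_sum, trace_sum]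
    refine Finset.sum_congr rfl fun p _ => ?_
    rw [hactn, trace_smul, htr, smul_eq_mul]
  rw [← Finset.sum_mul] at hfin
  have : (ℓ : ℂ) ^ 2 ≠ 0 := pow_ne_zero 2 hℓ
  apply mul_left_cancel₀ this
  rw [hfin]; ring

/-- Every function of the squared one-particle energies is summed over the momenta. -/
theorem sum_eigenvalues_sq (t : ℝ) (hσ : IsPiFlux σ a b) (g : ℝ → ℝ) :
    ∑ k, g ((isHermitian_oneParticle t σ).eigenvalues k ^ 2) =
      4 * ∑ p ∈ Finset.range ℓ ×ˢ Finset.range ℓ, g (t ^ 2 * dispersionSq ℓ a b p.1 p.2) := by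
  rw [← Finset.sum_coe_sort (Finset.range ℓ ×ˢ Finset.range ℓ)
    (fun p => g (t ^ 2 * dispersionSq ℓ a b p.1 p.2))]
  refine sum_comp_eq_of_sum_pow_eq _ _ 4 (fun n => ?_) g
  rw [Finset.sum_coe_sort (Finset.range ℓ ×ˢ Finset.range ℓ)
    (fun p => (t ^ 2 * dispersionSq ℓ a b p.1 p.2) ^ n)]
  have h1 := trace_oneParticle_pow t hσ n
  rw [← pow_mul, (isHermitian_oneParticle t σ).trace_pow_eq_sum] at h1
  simp only [← pow_mul]
  exact_mod_cast h1

/-- The one-particle spectrum is symmetric. -/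
theorem sum_eigenvalues_neg (t : ℝ) (hσ : ∀ x, plaquette σ x = -1) (g : ℝ → ℝ) :
    ∑ k, g ((isHermitian_oneParticle t σ).eigenvalues k) =
      ∑ k, g (-(isHermitian_oneParticle t σ).eigenvalues k) := by
  -- The unitary `T_0 T_1` conjugates `h` to `-h`, so odd power traces vanish.
  have hW : (shift σ 0 * shift σ 1) * oneParticle t σ =
      -oneParticle t σ * (shift σ 0 * shift σ 1) := by
    have h := shift_anticomm σ hσ
    have h1 := shift_anticomm_conjTranspose hσ
    have h2 : (shift σ 0)ᴴ * shift σ 1 = -(shift σ 1 * (shift σ 0)ᴴ) := by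
      have := congrArg conjTranspose h1
      simp only [conjTranspose_neg, conjTranspose_mul, conjTranspose_conjTranspose] at this
      rw [this, neg_neg]
    have u0 := shift_mul_conjTranspose σ 0
    have u1 := shift_mul_conjTranspose σ 1
    have v0 := conjTranspose_mul_shift σ 0
    have v1 := conjTranspose_mul_shift σ 1
    rw [oneParticle, Fin.sum_univ_two]
    set A := shift σ 0
    set B := shift σ 1
    have e1 : A * B * A = -(A * (A * B)) := by
      rw [mul_assoc, show B * A = -(A * B) by rw [h, neg_neg], mul_neg]
    have e2 : A * B * Aᴴ = -(Aᴴ * (A * B)) := by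
      rw [mul_assoc, show B * Aᴴ = -(Aᴴ * B) by rw [h2, neg_neg], mul_neg, ← mul_assoc, ← mul_assoc, u0, v0]
    have e3 : A * B * B = -(B * (A * B)) := by rw [← mul_assoc, h]; noncomm_ring
    have e4 : A * B * Bᴴ = -(Bᴴ * (A * B)) := by
      rw [← mul_assoc Bᴴ, ← neg_mul, ← h1, mul_assoc, mul_assoc, u1, v1]
    rw [mul_smul_comm, neg_mul, smul_mul_assoc, ← smul_neg]
    congr 1
    rw [mul_add, mul_add, mul_add, e1, e2, e3, e4]
    noncomm_ring
  have hU : (shift σ 0 * shift σ 1)ᴴ * (shift σ 0 * shift σ 1) = 1 := by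
    rw [conjTranspose_mul, mul_assoc, ← mul_assoc _ (shift σ 0), conjTranspose_mul_shift, one_mul,
      conjTranspose_mul_shift]
  have key : ∀ n, trace (oneParticle t σ ^ n) = (-1) ^ n * trace (oneParticle t σ ^ n) := by
    intro n
    have hs : SemiconjBy (shift σ 0 * shift σ 1) (oneParticle t σ) (-oneParticle t σ) := hW
    have h1 := (hs.pow_right n).eq
    have h2 := mul_eq_one_comm.mp hU
    calc trace (oneParticle t σ ^ n) = trace ((shift σ 0 * shift σ 1)ᴴ *
          ((shift σ 0 * shift σ 1) * oneParticle t σ ^ n)) := by rw [← mul_assoc, hU, one_mul]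
      _ = trace ((-oneParticle t σ) ^ n) := by
        rw [h1, trace_mul_comm, mul_assoc, h2, mul_one]
      _ = _ := by rw [neg_pow, ← neg_one_smul ℂ (1 : Matrix _ _ ℂ), smul_pow, one_pow,
        smul_mul_assoc, one_mul, trace_smul, smul_eq_mul]
  rw [← one_mul (∑ k, g (-(isHermitian_oneParticle t σ).eigenvalues k))]
  refine sum_comp_eq_of_sum_pow_eq _ _ 1 (fun n => ?_) g
  have h1 := key n
  rw [(isHermitian_oneParticle t σ).trace_pow_eq_sum] at h1
  simp only [neg_pow (Matrix.IsHermitian.eigenvalues _ _), ← Finset.mul_sum, one_mul]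
  exact_mod_cast h1

end Spectrum

end LatticeGauge

namespace LatticeGauge

/-! ### Riemann sums of the dispersion relation -/

section Conical

open Real

/-- The dispersion relation at fixed first momentum. -/
noncomputable def cone (c y : ℝ) : ℝ := √(c ^ 2 + sin y ^ 2)

theorem cone_pos {c : ℝ} (hc : 0 < c) (y : ℝ) : 0 < cone c y := Real.sqrt_pos.mpr (by positivity)

theorem cone_sq (c y : ℝ) : cone c y ^ 2 = c ^ 2 + sin y ^ 2 := Real.sq_sqrt (by positivity)

theorem hasDerivAt_cone {c : ℝ} (hc : 0 < c) (y : ℝ) :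
    HasDerivAt (cone c) (sin y * cos y / cone c y) y := by
  have h1 : HasDerivAt (fun y => c ^ 2 + sin y ^ 2) (2 * sin y * cos y) y := by
    simpa using ((hasDerivAt_sin y).pow 2).const_add (c ^ 2)
  have h2 := h1.sqrt (by positivity)
  have h3 := cone_pos hc y
  refine h2.congr_deriv ?_
  change 2 * sin y * cos y / (2 * cone c y) = _
  field_simp

/-- The second derivative of `cone c`. -/
noncomputable def coneDeriv2 (c y : ℝ) : ℝ := c ^ 2 * (1 + c ^ 2) / cone c y ^ 3 - cone c y

theorem hasDerivAt_coneDeriv {c : ℝ} (hc : 0 < c) (y : ℝ) :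
    HasDerivAt (fun y => sin y * cos y / cone c y) (coneDeriv2 c y) y := by
  have hp := cone_pos hc y
  have h := ((hasDerivAt_sin y).mul (hasDerivAt_cos y)).div (hasDerivAt_cone hc y) hp.ne'
  refine h.congr_deriv ?_
  have hs := cone_sq c y
  have hcs := Real.sin_sq_add_cos_sq y
  rw [coneDeriv2]
  simp only [Pi.mul_apply]
  set f := cone c y
  have e1 : sin y ^ 2 = f ^ 2 - c ^ 2 := by linarith
  have e2 : cos y ^ 2 = 1 - f ^ 2 + c ^ 2 := by linarith
  field_simp
  have : (cos y ^ 2 - sin y ^ 2) * f ^ 2 - sin y ^ 2 * cos y ^ 2 =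
      c ^ 2 * (1 + c ^ 2) - f ^ 4 := by rw [e1, e2]; ring
  linear_combination this

theorem abs_coneDeriv2_le {c : ℝ} (hc : 0 < c) (hc1 : c ≤ 1) (y : ℝ) :
    |coneDeriv2 c y| ≤ 2 / c := by
  have hp := cone_pos hc y
  have hs := cone_sq c y
  have hcf : c ≤ cone c y := by
    apply le_of_sq_le_sq _ hp.le
    rw [hs]; nlinarith [sq_nonneg (sin y)]
  have hf2 : cone c y ≤ 2 := by
    apply le_of_sq_le_sq _ (by norm_num)
    rw [hs]; nlinarith [Real.sin_sq_le_one y]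
  have h2 : 2 ≤ 2 / c := by rw [le_div_iff₀ hc]; linarith
  have h3 : c ^ 2 * (1 + c ^ 2) / cone c y ^ 3 ≤ 2 / c := by
    rw [div_le_div_iff₀ (by positivity) hc]
    have : c ^ 3 ≤ cone c y ^ 3 := pow_le_pow_left₀ hc.le hcf 3
    nlinarith [mul_nonneg (pow_pos hc 3).le (show 0 ≤ 1 - c ^ 2 by nlinarith)]
  have h4 : 0 ≤ c ^ 2 * (1 + c ^ 2) / cone c y ^ 3 := by positivity
  rw [coneDeriv2, abs_le]
  constructor <;> linarith

/-- As a function of the value of `cone` alone, the second derivative is decreasing, and `cone`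
increases on this interval. -/
theorem antitoneOn_coneDeriv2 {c : ℝ} (hc : 0 < c) :
    AntitoneOn (coneDeriv2 c) (Set.Icc 0 (π / 2)) := by
  intro x hx y hy hxy
  have hpi := Real.pi_pos
  have h0 : cone c x ≤ cone c y := by
    apply Real.sqrt_le_sqrt
    have h1 : sin x ≤ sin y := Real.sin_le_sin_of_le_of_le_pi_div_two (by linarith [hx.1]) hy.2 hxy
    have h2 : 0 ≤ sin x := Real.sin_nonneg_of_nonneg_of_le_pi hx.1 (by linarith [hx.2])
    gcongr
  have := cone_pos hc x
  unfold coneDeriv2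
  gcongr

/-- The second difference of `cone c` with step `d`. -/
noncomputable def coneDiff2 (c d y : ℝ) : ℝ := cone c (y + d) - 2 * cone c y + cone c (y - d)

/-- Mean value inequality twice: the `s`-derivative of `cone (y+s) + cone (y-s)` is at most
`(2/c)(2s) ≤ 4d/c`. -/
theorem abs_coneDiff2_le {c d : ℝ} (hc : 0 < c) (hc1 : c ≤ 1) (hd : 0 ≤ d) (y : ℝ) :
    |coneDiff2 c d y| ≤ 4 * d ^ 2 / c := by
  set f1 : ℝ → ℝ := fun y => sin y * cos y / cone c y
  have h1 : ∀ x z, |f1 x - f1 z| ≤ 2 / c * |x - z| := fun x z =>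
    Convex.norm_image_sub_le_of_norm_hasDerivWithin_le (s := Set.univ)
      (fun w _ => (hasDerivAt_coneDeriv hc w).hasDerivWithinAt)
      (fun w _ => abs_coneDeriv2_le hc hc1 w) convex_univ (Set.mem_univ z) (Set.mem_univ x)
  have h2 : ∀ s, HasDerivAt (fun s => cone c (y + s) + cone c (y - s)) (f1 (y + s) - f1 (y - s)) s := by
    intro s
    have a1 := (hasDerivAt_cone hc (y + s)).comp_const_add y s
    have a2 := (hasDerivAt_cone hc (y - s)).comp_const_sub y s
    exact (a1.add a2).congr_deriv (by ring)
  have h3 := Convex.norm_image_sub_le_of_norm_hasDerivWithin_le (s := Set.Icc 0 d)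
    (C := 4 * d / c) (fun w _ => (h2 w).hasDerivWithinAt) (fun w hw => by
      refine (h1 _ _).trans ?_
      rw [show y + w - (y - w) = 2 * w by ring, abs_of_nonneg (by linarith [hw.1]),
        show 2 / c * (2 * w) = 4 * w / c by ring]
      gcongr
      exact hw.2) (convex_Icc 0 d) (Set.left_mem_Icc.mpr hd) (Set.right_mem_Icc.mpr hd)
  simp only [Real.norm_eq_abs, sub_zero, abs_of_nonneg hd] at h3
  rw [coneDiff2]
  convert h3 using 1
  · congr 1; rw [add_zero]; ring
  · ring

/-- The derivative is a second difference of `cone'`, which is concave on `[0, π/2]`. The margin `d`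
keeps `y ± d` in that interval. -/
theorem antitoneOn_coneDiff2 {c d : ℝ} (hc : 0 < c) (hd : 0 ≤ d) :
    AntitoneOn (coneDiff2 c d) (Set.Icc d (π / 2 - d)) := by
  set f1 : ℝ → ℝ := fun y => sin y * cos y / cone c y
  have hconc : ConcaveOn ℝ (Set.Icc 0 (π / 2)) f1 := by
    refine AntitoneOn.concaveOn_of_deriv (convex_Icc _ _)
      (fun x _ => (hasDerivAt_coneDeriv hc x).continuousAt.continuousWithinAt)
      (fun x _ => (hasDerivAt_coneDeriv hc x).differentiableAt.differentiableWithinAt) ?_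
    have : deriv f1 = coneDeriv2 c := funext fun x => (hasDerivAt_coneDeriv hc x).deriv
    rw [this]
    exact (antitoneOn_coneDeriv2 hc).mono interior_subset
  have hder : ∀ y, HasDerivAt (coneDiff2 c d) (f1 (y + d) - 2 * f1 y + f1 (y - d)) y := by
    intro y
    have a1 := (hasDerivAt_cone hc (y + d)).comp_add_const y d
    have a2 := (hasDerivAt_cone hc (y - d)).comp_sub_const y d
    exact (a1.sub ((hasDerivAt_cone hc y).const_mul 2)).add a2
  refine antitoneOn_of_deriv_nonpos (convex_Icc _ _)
    (fun x _ => (hder x).continuousAt.continuousWithinAt)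
    (fun x _ => (hder x).differentiableAt.differentiableWithinAt) fun x hx => ?_
  rw [(hder x).deriv]
  have hx' := interior_subset hx
  have := hconc.2 (show x + d ∈ Set.Icc 0 (π / 2) from ⟨by linarith [hx'.1], by linarith [hx'.2]⟩)
    (show x - d ∈ Set.Icc 0 (π / 2) from ⟨by linarith [hx'.1], by linarith [hx'.2]⟩)
    (show (0 : ℝ) ≤ 1 / 2 by norm_num) (show (0 : ℝ) ≤ 1 / 2 by norm_num) (by norm_num)
  simp only [smul_eq_mul] at this
  rw [show 1 / 2 * (x + d) + 1 / 2 * (x - d) = x by ring] at this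
  linarith

theorem sum_range_mul_two {M : Type*} [AddCommMonoid M] (h : ℕ → M) (n : ℕ) :
    ∑ k ∈ Finset.range n, (h (2 * k) + h (2 * k + 1)) = ∑ j ∈ Finset.range (2 * n), h j := by
  induction n with
  | zero => simp
  | succ n ih =>
    rw [Finset.sum_range_succ, ih, mul_add, mul_one, Finset.sum_range_succ,
      Finset.sum_range_succ, add_assoc]

/-- Variation of a bounded sequence that is monotone away from its endpoints. -/
theorem sum_abs_sub_le {u : ℕ → ℝ} {B : ℝ} {n : ℕ} (hB : ∀ j, |u j| ≤ B)
    (hu : ∀ j, 1 ≤ j → j + 2 ≤ n → u (j + 1) ≤ u j) :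
    ∑ j ∈ Finset.range n, |u j - u (j + 1)| ≤ 6 * B := by
  have h2 : ∀ i j, |u i - u j| ≤ 2 * B := fun i j => by
    have h1 := abs_le.mp (hB i)
    have h2 := abs_le.mp (hB j)
    rw [abs_le]; constructor <;> linarith
  have hB0 : 0 ≤ B := (abs_nonneg _).trans (hB 0)
  match n with
  | 0 => simpa using hB0
  | 1 => simp only [Finset.sum_range_one]; linarith [h2 0 (0 + 1)]
  | n + 2 =>
    -- The two end increments cost `2B` each, and the monotone middle telescopes to at most `2B`.
    rw [Finset.sum_range_succ, Finset.sum_range_succ']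
    have h3 : ∑ j ∈ Finset.range n, |u (j + 1) - u (j + 1 + 1)| = u 1 - u (n + 1) := by
      rw [← Finset.sum_range_sub' (fun j => u (j + 1))]
      refine Finset.sum_congr rfl fun j hj => abs_of_nonneg ?_
      have := hu (j + 1) (by omega) (by have := Finset.mem_range.mp hj; omega)
      linarith
    rw [h3]
    have := (le_abs_self _).trans (h2 1 (n + 1))
    linarith [h2 0 (0 + 1), h2 (n + 1) (n + 1 + 1)]

/-- On the grid of step `d = π/(2ℓ)` the sum is an alternating sum over one period. Periodicity
rewrites it, up to the factor `-4`, as the alternating sum of second differences `u j`. That sum is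
at most the total variation of `u`, which is `O(d²/c)` because `u` is monotone inside each half
period. -/
theorem abs_sum_cone_sub_le {c : ℝ} (hc : 0 < c) (hc1 : c ≤ 1) {ℓ : ℕ} (hℓ : 0 < ℓ) :
    |∑ k ∈ Finset.range ℓ, (cone c (π * k / ℓ) - cone c (π * (k + 1 / 2) / ℓ))| ≤
      30 / (ℓ ^ 2 * c) := by
  have hℓ' : (0 : ℝ) < ℓ := Nat.cast_pos.mpr hℓ
  set d : ℝ := π / (2 * ℓ) with hd
  have hd0 : 0 < d := by positivity
  have hdℓ : d * ℓ = π / 2 := by rw [hd]; field_simp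
  have hper : ∀ y, cone c (y + π) = cone c y := fun y => by simp [cone, Real.sin_add_pi]
  have hrefl : ∀ y, cone c (π - y) = cone c y := fun y => by simp [cone, Real.sin_pi_sub]
  set u : ℕ → ℝ := fun j => coneDiff2 c d (d * j) with hu
  set B : ℝ := 4 * d ^ 2 / c
  have hB : ∀ j, |u j| ≤ B := fun j => abs_coneDiff2_le hc hc1 hd0.le _
  have hanti : ∀ j, 1 ≤ j → j + 2 ≤ ℓ → u (j + 1) ≤ u j := by
    intro j h1 h2
    have h1' : (1 : ℝ) ≤ j := by exact_mod_cast h1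
    have h2' : (j : ℝ) + 2 ≤ ℓ := by exact_mod_cast h2
    apply antitoneOn_coneDiff2 hc hd0.le
    · constructor <;> nlinarith
    · push_cast; constructor <;> nlinarith
    · push_cast; nlinarith
  have hV := sum_abs_sub_le hB hanti
  have hrefl_u : ∀ i j : ℕ, i + j = 2 * ℓ → u i = u j := by
    intro i j hij
    have h1 : (i : ℝ) = 2 * ℓ - j := by rw [eq_sub_iff_add_eq]; exact_mod_cast hij
    have h2 : d * i = π - d * j := by rw [h1]; linear_combination 2 * hdℓ
    simp only [hu, coneDiff2, h2]
    rw [← hrefl (π - d * j + d), ← hrefl (π - d * j), ← hrefl (π - d * j - d)]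
    rw [show π - (π - d * j + d) = d * j - d by ring, show π - (π - d * j) = d * j by ring,
      show π - (π - d * j - d) = d * j + d by ring]
    ring
  have hV2 : ∑ j ∈ Finset.range (2 * ℓ), |u j - u (j + 1)| ≤ 12 * B := by
    rw [two_mul ℓ, Finset.sum_range_add]
    have : ∑ x ∈ Finset.range ℓ, |u (ℓ + x) - u (ℓ + x + 1)| =
        ∑ j ∈ Finset.range ℓ, |u j - u (j + 1)| := by
      rw [← Finset.sum_range_reflect]
      refine Finset.sum_congr rfl fun j hj => ?_
      have := Finset.mem_range.mp hj
      rw [hrefl_u (ℓ + (ℓ - 1 - j)) (j + 1) (by omega),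
        hrefl_u (ℓ + (ℓ - 1 - j) + 1) j (by omega), abs_sub_comm]
    rw [this]
    linarith
  set G0 := ∑ k ∈ Finset.range ℓ, cone c (d * (2 * k))
  set G1 := ∑ k ∈ Finset.range ℓ, cone c (d * (2 * k + 1))
  have hG2 : ∑ k ∈ Finset.range ℓ, cone c (d * (2 * k + 2)) = G0 := by
    have h1 := Finset.sum_range_succ (fun k : ℕ => cone c (d * (2 * k))) ℓ
    rw [Finset.sum_range_succ'] at h1
    have h2 : cone c (d * (2 * (ℓ : ℕ))) = cone c (d * (2 * (0 : ℕ))) := by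
      rw [← hper (d * (2 * (0 : ℕ)))]; congr 1; push_cast; linear_combination 2 * hdℓ
    rw [h2, add_left_inj] at h1
    refine Eq.trans ?_ h1
    refine Finset.sum_congr rfl fun k _ => ?_
    push_cast; ring_nf
  have hG3 : ∑ k ∈ Finset.range ℓ, cone c (d * (2 * k - 1)) = G1 := by
    have h1 := Finset.sum_range_succ (fun k : ℕ => cone c (d * (2 * k - 1))) ℓ
    rw [Finset.sum_range_succ'] at h1
    have h2 : cone c (d * (2 * (ℓ : ℕ) - 1)) = cone c (d * (2 * (0 : ℕ) - 1)) := by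
      rw [← hper (d * (2 * (0 : ℕ) - 1))]; congr 1; push_cast; linear_combination 2 * hdℓ
    rw [h2, add_left_inj] at h1
    rw [← h1]
    refine Finset.sum_congr rfl fun k _ => ?_
    push_cast; ring_nf
  have hD : ∑ k ∈ Finset.range ℓ, (cone c (π * k / ℓ) - cone c (π * (k + 1 / 2) / ℓ)) =
      G0 - G1 := by
    rw [Finset.sum_sub_distrib]
    congr 1 <;> refine Finset.sum_congr rfl fun k _ => ?_ <;> congr 1 <;> rw [hd] <;> field_simp
  -- Each term is a third difference with weights 3, 3, 1, 1; by periodicity the even nodes sum to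
  -- `-4 G0` and the odd ones to `4 G1`.
  have hU : ∑ k ∈ Finset.range ℓ, (u (2 * k) - u (2 * k + 1)) = -4 * (G0 - G1) := by
    have e : ∀ k : ℕ, u (2 * k) - u (2 * k + 1) = 3 * cone c (d * (2 * k + 1)) -
        3 * cone c (d * (2 * k)) + cone c (d * (2 * k - 1)) - cone c (d * (2 * k + 2)) := by
      intro k
      simp only [hu, coneDiff2]
      push_cast
      rw [show d * (2 * k) + d = d * (2 * k + 1) by ring, show d * (2 * k) - d = d * (2 * k - 1) by
        ring, show d * (2 * k + 1) + d = d * (2 * k + 2) by ring,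
        show d * (2 * k + 1) - d = d * (2 * (k : ℝ)) by ring]
      ring
    rw [Finset.sum_congr rfl fun k _ => e k, Finset.sum_sub_distrib, Finset.sum_add_distrib,
      Finset.sum_sub_distrib, hG2, hG3, ← Finset.mul_sum, ← Finset.mul_sum]
    ring
  have hle : |∑ k ∈ Finset.range ℓ, (u (2 * k) - u (2 * k + 1))| ≤ 12 * B := by
    refine (Finset.abs_sum_le_sum_abs _ _).trans (le_trans ?_ hV2)
    rw [← sum_range_mul_two]
    exact Finset.sum_le_sum fun k _ => le_add_of_nonneg_right (abs_nonneg _)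
  rw [hU, abs_mul, abs_neg, abs_of_pos (by norm_num : (0 : ℝ) < 4)] at hle
  rw [hD]
  have hB2 : 3 * B ≤ 30 / (ℓ ^ 2 * c) := by
    have : 3 * B = 3 * π ^ 2 / (ℓ ^ 2 * c) := by simp only [B, hd]; field_simp; ring
    rw [this]
    gcongr
    nlinarith [Real.pi_lt_d2, Real.pi_gt_three]
  linarith

/-- The row through the cone point, where the bound in `1/c` is useless. Here `cone 0` is `|sin|`,
and multiplying by `2 sin d` telescopes the sum to `2 (cos d - 1)`. -/
theorem abs_sum_cone_zero_sub_le {ℓ : ℕ} (hℓ : 0 < ℓ) :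
    |∑ k ∈ Finset.range ℓ, (cone 0 (π * k / ℓ) - cone 0 (π * (k + 1 / 2) / ℓ))| ≤ 2 / ℓ := by
  have hℓ' : (0 : ℝ) < ℓ := Nat.cast_pos.mpr hℓ
  have hpi := Real.pi_pos
  set d : ℝ := π / (2 * ℓ) with hd
  have hd0 : 0 < d := by positivity
  have hdℓ : d * (2 * ℓ) = π := by rw [hd]; field_simp
  have hd2 : d ≤ π / 2 := by
    rw [hd]; apply div_le_div_of_nonneg_left hpi.le (by norm_num)
    have : (1 : ℝ) ≤ ℓ := by exact_mod_cast hℓ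
    linarith
  have hcone : ∀ y, 0 ≤ y → y ≤ π → cone 0 y = sin y := by
    intro y h1 h2
    rw [cone, zero_pow two_ne_zero, zero_add, Real.sqrt_sq (Real.sin_nonneg_of_nonneg_of_le_pi h1 h2)]
  have h1 : ∑ k ∈ Finset.range ℓ, (cone 0 (π * k / ℓ) - cone 0 (π * (k + 1 / 2) / ℓ)) =
      ∑ k ∈ Finset.range ℓ, (sin (d * (2 * k)) - sin (d * (2 * k + 1))) := by
    refine Finset.sum_congr rfl fun k hk => ?_
    have hk' : (k : ℝ) + 1 ≤ ℓ := by exact_mod_cast Finset.mem_range.mp hk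
    have e1 : π * k / ℓ = d * (2 * k) := by rw [hd]; field_simp
    have e2 : π * (k + 1 / 2) / ℓ = d * (2 * k + 1) := by rw [hd]; field_simp
    rw [e1, e2, hcone _ (by positivity) (by rw [← hdℓ]; exact mul_le_mul_of_nonneg_left (by linarith) hd0.le),
      hcone _ (by positivity) (by rw [← hdℓ]; exact mul_le_mul_of_nonneg_left (by linarith) hd0.le)]
  have h2 : ∀ n : ℕ, 2 * sin d * ∑ k ∈ Finset.range n, (sin (d * (2 * k)) - sin (d * (2 * k + 1))) =
      cos d - cos (d * (2 * n) - d) - 1 + cos (d * (2 * n)) := by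
    intro n
    induction n with
    | zero => simp
    | succ n ih =>
      rw [Finset.sum_range_succ, mul_add, ih]
      push_cast
      rw [show d * (2 * ((n : ℝ) + 1)) - d = d * (2 * n) + d by ring,
        show d * (2 * ((n : ℝ) + 1)) = d * (2 * n) + d + d by ring,
        show d * (2 * (n : ℝ) + 1) = d * (2 * n) + d by ring]
      simp only [Real.cos_add, Real.sin_add, Real.cos_sub]
      have := Real.sin_sq_add_cos_sq d
      linear_combination (-cos (d * (2 * n))) * this
  have h3 := h2 ℓ
  rw [hdℓ, Real.cos_pi_sub, Real.cos_pi] at h3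
  rw [h1]
  set D := ∑ k ∈ Finset.range ℓ, (sin (d * (2 * k)) - sin (d * (2 * k + 1)))
  have hs : 2 / π * d ≤ sin d := Real.mul_le_sin hd0.le hd2
  have hs0 : 0 < sin d := lt_of_lt_of_le (by positivity) hs
  have hcos := Real.one_sub_sq_div_two_le_cos (x := d)
  have hcos1 := Real.cos_le_one d
  have hDle : |D| * sin d ≤ d ^ 2 / 2 := by
    rw [← abs_of_pos hs0, ← abs_mul, show D * sin d = cos d - 1 by linarith, abs_sub_comm,
      abs_of_nonneg (by linarith)]
    linarith
  have h4 : |D| * (2 / π * d) ≤ d ^ 2 / 2 :=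
    (mul_le_mul_of_nonneg_left hs (abs_nonneg _)).trans hDle
  have h5 : |D| ≤ π / 4 * d := by
    have : |D| * (2 / π * d) ≤ (π / 4 * d) * (2 / π * d) := by
      refine h4.trans (le_of_eq ?_); field_simp; ring
    exact le_of_mul_le_mul_right this (by positivity)
  refine h5.trans ?_
  rw [hd, show π / 4 * (π / (2 * ℓ)) = (π ^ 2 / 8) / ℓ by field_simp; ring]
  gcongr
  nlinarith [Real.pi_lt_d2]

/-- The double Riemann sum of the dispersion relation with shifts `α`, `γ`. -/
noncomputable def coneSum (ℓ : ℕ) (α γ : ℝ) : ℝ :=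
  ∑ j ∈ Finset.range ℓ, ∑ k ∈ Finset.range ℓ,
    √(sin (π * (j + α) / ℓ) ^ 2 + sin (π * (k + γ) / ℓ) ^ 2)

theorem coneSum_comm (ℓ : ℕ) (α γ : ℝ) : coneSum ℓ α γ = coneSum ℓ γ α := by
  rw [coneSum, Finset.sum_comm, coneSum]
  simp only [add_comm]

/-- Jordan's inequality at the nearer endpoint. The bound is a sum over both endpoints, so it later
splits into two harmonic sums. -/
theorem inv_sin_le {x : ℝ} (h0 : 0 < x) (h1 : x < 1) :
    (sin (π * x))⁻¹ ≤ (1 / x + 1 / (1 - x)) / 2 := by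
  have hpi := Real.pi_pos
  have h2 : 2 * min x (1 - x) ≤ sin (π * x) := by
    rcases le_total x (1 / 2) with h | h
    · have := Real.mul_le_sin (x := π * x) (by positivity) (by nlinarith)
      rw [show 2 / π * (π * x) = 2 * x by field_simp] at this
      exact (mul_le_mul_of_nonneg_left (min_le_left _ _) (by norm_num)).trans this
    · have := Real.mul_le_sin (x := π * (1 - x)) (by nlinarith) (by nlinarith)
      rw [show 2 / π * (π * (1 - x)) = 2 * (1 - x) by field_simp,
        show π * (1 - x) = π - π * x by ring, Real.sin_pi_sub] at this
      exact (mul_le_mul_of_nonneg_left (min_le_right _ _) (by norm_num)).trans this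
  have h3 : 0 < 1 - x := by linarith
  have h4 : 0 < min x (1 - x) := lt_min h0 h3
  refine (inv_anti₀ (by positivity) h2).trans ?_
  rw [mul_inv, mul_comm, ← div_eq_mul_inv]
  gcongr
  rcases min_choice x (1 - x) with h | h <;> rw [h, ← one_div]
  · linarith [one_div_pos.mpr h3]
  · linarith [one_div_pos.mpr h0]

theorem abs_coneSum_sub_le {ℓ : ℕ} (hℓ : 0 < ℓ) {α : ℝ} (hα : α = 0 ∨ α = 1 / 2) :
    |coneSum ℓ α 0 - coneSum ℓ α (1 / 2)| ≤ 60 * (1 + log ℓ) / ℓ := by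
  have hℓ' : (0 : ℝ) < ℓ := Nat.cast_pos.mpr hℓ
  have hterm : ∀ j ∈ Finset.range ℓ,
      |∑ k ∈ Finset.range ℓ, (cone (sin (π * (j + α) / ℓ)) (π * k / ℓ) -
        cone (sin (π * (j + α) / ℓ)) (π * (k + 1 / 2) / ℓ))| ≤
      -- The form `ℓ - 1 - j + 1` of `ℓ - j` makes the second sum the reflection of the first.
      30 / ℓ * (((j + 1 : ℕ) : ℝ)⁻¹ + ((ℓ - 1 - j + 1 : ℕ) : ℝ)⁻¹) := by
    intro j hj
    have hj1 := Finset.mem_range.mp hj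
    have hj' : (j : ℝ) + 1 ≤ ℓ := by exact_mod_cast hj1
    have hcast : ((ℓ - 1 - j + 1 : ℕ) : ℝ) = ℓ - j := by
      rw [show ℓ - 1 - j + 1 = ℓ - j by omega, Nat.cast_sub hj1.le]
    rw [hcast]; push_cast
    have hlj : (0 : ℝ) < ℓ - j := by linarith
    by_cases h0 : j = 0 ∧ α = 0
    · obtain ⟨rfl, rfl⟩ := h0
      simp only [Nat.cast_zero, zero_add, mul_zero, zero_div, sin_zero]
      refine (abs_sum_cone_zero_sub_le hℓ).trans ?_
      have : (0 : ℝ) ≤ ((ℓ : ℝ) - 0)⁻¹ := by rw [sub_zero]; positivity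
      rw [div_mul_eq_mul_div]
      gcongr
      linarith [inv_one (G := ℝ)]
    -- This lower bound fails only for `j = 0`, `α = 0`, the row already treated.
    · have hja : ((j : ℝ) + 1) / 2 ≤ j + α := by
        rcases hα with rfl | rfl
        · have : 1 ≤ j := by
            by_contra h
            exact h0 ⟨by omega, rfl⟩
          have : (1 : ℝ) ≤ j := by exact_mod_cast this
          linarith
        · have : (0 : ℝ) ≤ j := Nat.cast_nonneg j
          linarith
      have hjb : ((ℓ : ℝ) - j) / 2 ≤ ℓ - (j + α) := by
        rcases hα with rfl | rfl <;> linarith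
      have hjpos : (0 : ℝ) < j + 1 := by positivity
      set x : ℝ := (j + α) / ℓ with hx
      have hx0 : 0 < x := by apply div_pos _ hℓ'; linarith
      have hx1 : x < 1 := by rw [hx, div_lt_one hℓ']; linarith
      have hpi := Real.pi_pos
      rw [show π * (j + α) / ℓ = π * x by rw [hx]; ring]
      have hs0 : 0 < sin (π * x) := Real.sin_pos_of_pos_of_lt_pi (by positivity) (by nlinarith)
      refine (abs_sum_cone_sub_le hs0 (Real.sin_le_one _) hℓ).trans ?_
      have h1 := inv_sin_le hx0 hx1
      have h2 : 1 / x ≤ 2 * ℓ * ((j : ℝ) + 1)⁻¹ := by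
        rw [hx, one_div_div, ← div_eq_mul_inv, div_le_div_iff₀ (by linarith) hjpos]
        nlinarith
      have h3 : 1 / (1 - x) ≤ 2 * ℓ * ((ℓ : ℝ) - j)⁻¹ := by
        rw [show 1 - x = (ℓ - (j + α)) / ℓ by rw [hx]; field_simp, one_div_div, ← div_eq_mul_inv,
          div_le_div_iff₀ (by linarith) hlj]
        nlinarith
      calc 30 / (ℓ ^ 2 * sin (π * x)) = 30 / ℓ ^ 2 * (sin (π * x))⁻¹ := by
            rw [div_mul_eq_div_div, div_eq_mul_inv (30 / (ℓ : ℝ) ^ 2)]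
        _ ≤ 30 / ℓ ^ 2 * (ℓ * ((j : ℝ) + 1)⁻¹ + ℓ * ((ℓ : ℝ) - j)⁻¹) := by
            gcongr; linarith
        _ = _ := by field_simp
  have hsum : coneSum ℓ α 0 - coneSum ℓ α (1 / 2) = ∑ j ∈ Finset.range ℓ,
      ∑ k ∈ Finset.range ℓ, (cone (sin (π * (j + α) / ℓ)) (π * k / ℓ) -
        cone (sin (π * (j + α) / ℓ)) (π * (k + 1 / 2) / ℓ)) := by
    simp only [coneSum, Finset.sum_sub_distrib, cone, add_zero]
  rw [hsum]
  refine (Finset.abs_sum_le_sum_abs _ _).trans ((Finset.sum_le_sum hterm).trans ?_)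
  rw [← Finset.mul_sum, Finset.sum_add_distrib,
    Finset.sum_range_reflect (fun j => ((j + 1 : ℕ) : ℝ)⁻¹) ℓ]
  have hH := harmonic_le_one_add_log ℓ
  rw [harmonic] at hH
  push_cast at hH ⊢
  calc _ = 60 * (∑ j ∈ Finset.range ℓ, ((j : ℝ) + 1)⁻¹) / ℓ := by ring
    _ ≤ _ := by gcongr

/-- The shifts are removed one at a time, using the symmetry of `coneSum` for the second. -/
theorem abs_coneSum_sub_coneSum_zero_le {ℓ : ℕ} (hℓ : 0 < ℓ) {α γ : ℝ} (hα : α = 0 ∨ α = 1 / 2)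
    (hγ : γ = 0 ∨ γ = 1 / 2) :
    |coneSum ℓ α γ - coneSum ℓ 0 0| ≤ 120 * (1 + log ℓ) / ℓ := by
  have hlog : 0 ≤ 60 * (1 + log ℓ) / ℓ := by
    have := Real.log_natCast_nonneg ℓ
    positivity
  have h1 : ∀ {α γ : ℝ}, (α = 0 ∨ α = 1 / 2) → (γ = 0 ∨ γ = 1 / 2) →
      |coneSum ℓ α γ - coneSum ℓ α 0| ≤ 60 * (1 + log ℓ) / ℓ := by
    intro α γ hα hγ
    rcases hγ with rfl | rfl
    · rw [sub_self, abs_zero]; exact hlog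
    · rw [abs_sub_comm]; exact abs_coneSum_sub_le hℓ hα
  have h2 := h1 hα hγ
  have h3 := h1 (Or.inl rfl) hα
  rw [coneSum_comm ℓ 0 α] at h3
  have h4 := abs_sub_le (coneSum ℓ α γ) (coneSum ℓ α 0) (coneSum ℓ 0 0)
  calc _ ≤ _ := h4
    _ ≤ 60 * (1 + log ℓ) / ℓ + 60 * (1 + log ℓ) / ℓ := add_le_add h2 h3
    _ = _ := by ring

end Conical

end LatticeGauge

namespace LatticeGauge

open Matrix Filter Topology

/-! ### Zero-temperature limits and the sign of the odd partition function. -/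

section GroundState

/-- One mode contributes `-min(e, 0)` to the free energy at zero temperature. -/
theorem tendsto_log_one_add_exp {ε : ℤˣ} {e : ℝ} (h : ε = 1 ∨ e ≠ 0) :
    Tendsto (fun β : ℝ => 1 / β * Real.log (1 + ((ε : ℤ) : ℝ) * Real.exp (-β * e))) atTop
      (𝓝 ((|e| - e) / 2)) := by
  have hε : ((ε : ℤ) : ℝ) * ((ε : ℤ) : ℝ) = 1 := by
    rcases Int.units_eq_one_or ε with rfl | rfl <;> norm_num
  -- `Real.log` ignores signs, so single modes can be treated although `1 - exp (-βe)` is negative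
  -- for `e < 0`.
  have hlog : ∀ x : ℝ, Real.log (((ε : ℤ) : ℝ) * x) = Real.log x := by
    intro x
    rcases Int.units_eq_one_or ε with rfl | rfl <;> simp
  have hne : ∀ β : ℝ, 0 < β → 1 + ((ε : ℤ) : ℝ) * Real.exp (-β * |e|) ≠ 0 := by
    intro β hβ
    rcases Int.units_eq_one_or ε with rfl | rfl
    · simp only [Units.val_one, Int.cast_one, one_mul]; positivity
    · have he : e ≠ 0 := h.resolve_left (by decide)
      have : Real.exp (-β * |e|) < 1 := by
        rw [Real.exp_lt_one_iff]
        nlinarith [abs_pos.mpr he]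
      simp only [Units.val_neg, Units.val_one, Int.cast_neg, Int.cast_one]
      linarith
  have hsplit : ∀ β : ℝ, 0 < β → 1 / β * Real.log (1 + ((ε : ℤ) : ℝ) * Real.exp (-β * e)) =
      (|e| - e) / 2 + 1 / β * Real.log (1 + ((ε : ℤ) : ℝ) * Real.exp (-β * |e|)) := by
    intro β hβ
    rcases le_or_gt 0 e with he | he
    · rw [abs_of_nonneg he, sub_self, zero_div, zero_add]
    · have h1 : 1 + ((ε : ℤ) : ℝ) * Real.exp (-β * e) = ((ε : ℤ) : ℝ) *
          (Real.exp (-β * e) * (1 + ((ε : ℤ) : ℝ) * Real.exp (-β * |e|))) := by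
        have : Real.exp (-β * e) * Real.exp (-β * |e|) = 1 := by
          rw [← Real.exp_add, abs_of_neg he]; simp
        linear_combination (-1 : ℝ) * hε - ((ε : ℤ) : ℝ) * ((ε : ℤ) : ℝ) * this
      rw [h1, hlog, Real.log_mul (Real.exp_ne_zero _) (hne β hβ), Real.log_exp, abs_of_neg he]
      field_simp
      ring
  have hzero : Tendsto (fun β : ℝ => 1 / β * Real.log (1 + ((ε : ℤ) : ℝ) * Real.exp (-β * |e|)))
      atTop (𝓝 0) := by
    have hinv : Tendsto (fun β : ℝ => 1 / β) atTop (𝓝 0) := by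
      simpa using tendsto_inv_atTop_zero (𝕜 := ℝ)
    by_cases he : e = 0
    · subst he
      simpa using hinv.mul_const (Real.log (1 + ((ε : ℤ) : ℝ)))
    · have h1 : Tendsto (fun β : ℝ => Real.exp (-β * |e|)) atTop (𝓝 0) := by
        refine Real.tendsto_exp_atBot.comp ?_
        exact tendsto_neg_atTop_atBot.atBot_mul_const (abs_pos.mpr he)
      have h2 : Tendsto (fun β : ℝ => 1 + ((ε : ℤ) : ℝ) * Real.exp (-β * |e|)) atTop (𝓝 1) := by
        simpa using (h1.const_mul ((ε : ℤ) : ℝ)).const_add 1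
      have h3 := (Real.continuousAt_log one_ne_zero).tendsto.comp h2
      rw [Real.log_one] at h3
      simpa using hinv.mul h3
  have h4 := hzero.const_add ((|e| - e) / 2)
  rw [add_zero] at h4
  refine h4.congr' ?_
  filter_upwards [eventually_gt_atTop 0] with β hβ
  exact (hsplit β hβ).symm

variable {ℓ : ℕ} {a b : ℤˣ}

theorem fluxShift_eq (a : ℤˣ) : fluxShift ℓ a = 0 ∨ fluxShift ℓ a = 1 / 2 := by
  unfold fluxShift; split_ifs <;> simp

theorem dispersionSq_pos (h : (a, b) ≠ (refFlux ℓ, refFlux ℓ)) {j k : ℕ} (hj : j < ℓ)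
    (hk : k < ℓ) : 0 < dispersionSq ℓ a b j k := by
  have key : ∀ (c : ℤˣ) (i : ℕ), i < ℓ → c ≠ refFlux ℓ →
      0 < Real.sin (Real.pi * (i + fluxShift ℓ c) / ℓ) := by
    intro c i hi hc
    have hpi := Real.pi_pos
    have hi' : (i : ℝ) + 1 ≤ ℓ := by exact_mod_cast hi
    have hℓ : (0 : ℝ) < ℓ := by linarith [(Nat.cast_nonneg i : (0 : ℝ) ≤ i)]
    rw [fluxShift, if_neg hc]
    apply Real.sin_pos_of_pos_of_lt_pi
    · positivity
    · rw [div_lt_iff₀ hℓ]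
      exact mul_lt_mul_of_pos_left (by linarith) hpi
  rw [dispersionSq]
  by_cases ha : a = refFlux ℓ
  · have hb : b ≠ refFlux ℓ := fun hb => h (by rw [ha, hb])
    have := key b k hk hb
    positivity
  · have := key a j hj ha
    positivity

variable [NeZero ℓ] {σ : GaugeField (2 * ℓ)}

/-- Taking the indicator of zero in `sum_eigenvalues_sq` counts the zero modes. -/
theorem eigenvalues_ne_zero {t : ℝ} (ht : 0 < t) (hσ : IsPiFlux σ a b)
    (h : (a, b) ≠ (refFlux ℓ, refFlux ℓ)) (k : Site (2 * ℓ)) :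
    (isHermitian_oneParticle t σ).eigenvalues k ≠ 0 := by
  have h1 := sum_eigenvalues_sq t hσ fun x => if x = 0 then 1 else 0
  rw [Finset.sum_eq_zero (s := Finset.range ℓ ×ˢ Finset.range ℓ), mul_zero] at h1
  · rw [Finset.sum_eq_zero_iff_of_nonneg fun i _ => by split_ifs <;> norm_num] at h1
    intro hk
    have := h1 k (Finset.mem_univ k)
    rw [hk] at this
    simp at this
  · intro p hp
    rw [Finset.mem_product, Finset.mem_range, Finset.mem_range] at hp
    have := dispersionSq_pos h hp.1 hp.2
    rw [if_neg]
    positivity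

theorem exists_eigenvalues_eq_zero (t : ℝ) (hσ : IsPiFlux σ (refFlux ℓ) (refFlux ℓ)) :
    ∃ k, (isHermitian_oneParticle t σ).eigenvalues k = 0 := by
  by_contra! hne
  have h1 := sum_eigenvalues_sq t hσ fun x => if x = 0 then 1 else 0
  rw [Finset.sum_eq_zero fun k _ => if_neg (pow_ne_zero 2 (hne k))] at h1
  have h2 : (0 : ℝ) < ∑ p ∈ Finset.range ℓ ×ˢ Finset.range ℓ,
      if t ^ 2 * dispersionSq ℓ (refFlux ℓ) (refFlux ℓ) p.1 p.2 = 0 then 1 else 0 := by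
    refine Finset.sum_pos' (fun i _ => by split_ifs <;> norm_num)
      ⟨(0, 0), by simp [Nat.pos_of_neZero], ?_⟩
    simp [dispersionSq, fluxShift]
  linarith

theorem sum_eigenvalues_eq_zero (t : ℝ) (hσ : ∀ x, plaquette σ x = -1) :
    ∑ k, (isHermitian_oneParticle t σ).eigenvalues k = 0 := by
  have := sum_eigenvalues_neg t hσ id
  simp only [id, Finset.sum_neg_distrib] at this
  linarith

theorem sum_abs_eigenvalues {t : ℝ} (ht : 0 < t) (hσ : IsPiFlux σ a b) :
    ∑ k, |(isHermitian_oneParticle t σ).eigenvalues k| =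
      8 * t * coneSum ℓ (fluxShift ℓ a) (fluxShift ℓ b) := by
  simp only [← Real.sqrt_sq_eq_abs]
  rw [sum_eigenvalues_sq t hσ, coneSum, ← Finset.sum_product', Finset.mul_sum, Finset.mul_sum]
  refine Finset.sum_congr rfl fun p _ => ?_
  rw [dispersionSq, ← mul_assoc, Real.sqrt_mul (by positivity),
    show t ^ 2 * 4 = (2 * t) ^ 2 by ring, Real.sqrt_sq (by positivity)]
  ring

/-- A symmetric spectrum without zero splits the `4ℓ²` eigenvalues into two halves of size `2ℓ²`. -/
theorem even_card_neg {t : ℝ} (hσ : ∀ x, plaquette σ x = -1)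
    (hne : ∀ k, (isHermitian_oneParticle t σ).eigenvalues k ≠ 0) :
    Even (Finset.univ.filter fun k => (isHermitian_oneParticle t σ).eigenvalues k < 0).card := by
  have h1 := sum_eigenvalues_neg t hσ fun x => if x < 0 then 1 else 0
  simp only [Left.neg_neg_iff, Finset.sum_boole] at h1
  have h1' := Nat.cast_injective (R := ℝ) h1
  have h2 := Finset.card_filter_add_card_filter_not (s := Finset.univ)
    (fun k => (isHermitian_oneParticle t σ).eigenvalues k < 0)
  have h3 : (Finset.univ.filter fun k => ¬ (isHermitian_oneParticle t σ).eigenvalues k < 0) =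
      Finset.univ.filter fun k => 0 < (isHermitian_oneParticle t σ).eigenvalues k := by
    refine Finset.filter_congr fun k _ => ?_
    rw [not_lt, le_iff_lt_or_eq, or_iff_left (hne k).symm]
  rw [h3, ← h1', Finset.card_univ, Fintype.card_prod, ZMod.card] at h2
  exact ⟨ℓ * ℓ, by linarith⟩

theorem prod_one_sub_exp_pos {t β : ℝ} (hβ : 0 < β) (hσ : ∀ x, plaquette σ x = -1)
    (hne : ∀ k, (isHermitian_oneParticle t σ).eigenvalues k ≠ 0) :
    0 < ∏ k, (1 - Real.exp (-β * (isHermitian_oneParticle t σ).eigenvalues k)) := by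
  rw [← Finset.prod_filter_mul_prod_filter_not _
    (fun k => (isHermitian_oneParticle t σ).eigenvalues k < 0)]
  refine mul_pos ?_ (Finset.prod_pos fun k hk => ?_)
  · have : ∀ k, (1 - Real.exp (-β * (isHermitian_oneParticle t σ).eigenvalues k)) =
        -(Real.exp (-β * (isHermitian_oneParticle t σ).eigenvalues k) - 1) := fun k => by ring
    simp only [this]
    rw [Finset.prod_neg, (even_card_neg hσ hne).neg_one_pow, one_mul]
    refine Finset.prod_pos fun k hk => ?_
    rw [sub_pos, Real.one_lt_exp_iff]
    nlinarith [(Finset.mem_filter.mp hk).2]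
  · rw [sub_pos, Real.exp_lt_one_iff]
    have h1 := lt_of_le_of_ne (not_lt.mp (Finset.mem_filter.mp hk).2) (hne k).symm
    nlinarith

theorem oddPartition_eq (t β : ℝ) (hσ : ∀ x, plaquette σ x = -1) :
    oddPartition t β σ = ((Real.exp (-β * ((2 * ℓ : ℕ) : ℝ) ^ 2) * ∏ k,
      (1 - Real.exp (-β * (isHermitian_oneParticle t σ).eigenvalues k)) : ℝ) : ℂ) := by
  have h1 := partitionFn_eq (-1) t β σ hσ
  rw [partitionFn, if_neg (by decide)] at h1
  rw [h1]
  simp [sub_eq_add_neg]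

/-- The limit is taken mode by mode, all factors being nonzero outside the excluded case. Since the
energies sum to zero, only half the sum of `|e_k|` survives. -/
theorem tendsto_freeEnergy {ε : ℤˣ} {t : ℝ} (ht : 0 < t) (hσ : IsPiFlux σ a b)
    (h : (ε, a, b) ≠ (-1, refFlux ℓ, refFlux ℓ)) :
    Tendsto (freeEnergy ε t σ) atTop (𝓝 (((2 * ℓ : ℕ) : ℝ) ^ 2 -
      4 * t * coneSum ℓ (fluxShift ℓ a) (fluxShift ℓ b))) := by
  have hne : ∀ k, ε = 1 ∨ (isHermitian_oneParticle t σ).eigenvalues k ≠ 0 := by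
    intro k
    rcases Int.units_eq_one_or ε with rfl | rfl
    · exact Or.inl rfl
    · exact Or.inr (eigenvalues_ne_zero ht hσ (fun h' => h (by rw [h'])) k)
  have hlim := tendsto_finsetSum Finset.univ fun k _ => tendsto_log_one_add_exp (hne k)
  have hval : ∑ k, (|(isHermitian_oneParticle t σ).eigenvalues k| -
      (isHermitian_oneParticle t σ).eigenvalues k) / 2 =
      4 * t * coneSum ℓ (fluxShift ℓ a) (fluxShift ℓ b) := by
    rw [← Finset.sum_div, Finset.sum_sub_distrib, sum_abs_eigenvalues ht hσ,
      sum_eigenvalues_eq_zero t hσ.plaquette_eq]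
    ring
  rw [hval] at hlim
  refine (hlim.const_sub (((2 * ℓ : ℕ) : ℝ) ^ 2)).congr' ?_
  filter_upwards [eventually_gt_atTop 0] with β hβ
  have hf : ∀ k, 1 + ((ε : ℤ) : ℝ) *
      Real.exp (-β * (isHermitian_oneParticle t σ).eigenvalues k) ≠ 0 := by
    intro k
    rcases Int.units_eq_one_or ε with rfl | rfl
    · simp only [Units.val_one, Int.cast_one, one_mul]; positivity
    · have he := (hne k).resolve_left (by decide)
      simp only [Units.val_neg, Units.val_one, Int.cast_neg, Int.cast_one, neg_one_mul]
      rw [← sub_eq_add_neg, sub_ne_zero]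
      intro h1
      have := Real.exp_eq_one_iff _ |>.mp h1.symm
      rw [mul_eq_zero] at this
      rcases this with h2 | h2
      · linarith
      · exact he h2
  rw [freeEnergy, partitionFn_eq ε t β σ hσ.plaquette_eq, Complex.ofReal_re,
    Real.log_mul (Real.exp_ne_zero _) (Finset.prod_ne_zero_iff.mpr fun k _ => hf k), Real.log_exp,
    Real.log_prod fun k _ => hf k, ← Finset.mul_sum]
  field_simp
  ring

end GroundState

/-- The logarithmic correction is absorbed by any positive power. -/
theorem one_add_log_div_le {ℓ : ℕ} (hℓ : 0 < ℓ) {α : ℝ} (hα : 0 < α) :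
    (1 + Real.log ℓ) / ℓ ≤ 2 * (1 + 1 / (3 * α)) / ((2 * ℓ : ℕ) : ℝ) ^ (1 - 3 * α) := by
  have hℓ' : (1 : ℝ) ≤ ℓ := by exact_mod_cast hℓ
  have hL : (1 : ℝ) ≤ ((2 * ℓ : ℕ) : ℝ) := by push_cast; linarith
  set M : ℝ := ((2 * ℓ : ℕ) : ℝ) with hM
  have hM' : M = 2 * ℓ := by rw [hM]; push_cast; ring
  have hM0 : 0 < M := by linarith
  -- The inequality `log x ≤ x^s / s` with `s = 3α` fixes the constant.
  have h1 : Real.log ℓ ≤ M ^ (3 * α) / (3 * α) :=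
    (Real.log_le_log (by linarith) (by linarith)).trans (Real.log_le_rpow_div hM0.le (by positivity))
  have h2 : 1 ≤ M ^ (3 * α) := Real.one_le_rpow hL (by positivity)
  have h3 : M ^ (1 - 3 * α) * M ^ (3 * α) = M := by
    rw [← Real.rpow_add hM0]; simp
  rw [div_le_div_iff₀ (by linarith) (by positivity)]
  calc (1 + Real.log ℓ) * M ^ (1 - 3 * α) ≤
        (M ^ (3 * α) + M ^ (3 * α) / (3 * α)) * M ^ (1 - 3 * α) := by gcongr
    _ = (1 + 1 / (3 * α)) * (M ^ (1 - 3 * α) * M ^ (3 * α)) := by ring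
    _ = _ := by rw [h3, hM']; ring

end LatticeGauge

theorem proposition3p1 :
    (∀ (t : ℝ), 0 < t → ∀ (ℓ : ℕ) [NeZero ℓ] (a b : ℤˣ) (σ : LatticeGauge.GaugeField (2 * ℓ)),
      LatticeGauge.IsPiFlux σ a b → ∀ β : ℝ, 0 < β →
        ((a, b) = (LatticeGauge.refFlux ℓ, LatticeGauge.refFlux ℓ) →
          LatticeGauge.oddPartition t β σ = 0) ∧
        ((a, b) ≠ (LatticeGauge.refFlux ℓ, LatticeGauge.refFlux ℓ) →
          0 < LatticeGauge.oddPartition t β σ)) ∧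
    (∀ α : ℝ, 0 < α → α < 1 / 3 → ∃ C : ℝ, 0 < C ∧
      ∀ (t : ℝ), 0 < t → ∀ (ℓ : ℕ) [NeZero ℓ] (ε a b : ℤˣ),
        (ε, a, b) ≠ (-1, LatticeGauge.refFlux ℓ, LatticeGauge.refFlux ℓ) →
        ∀ σ σ₀ : LatticeGauge.GaugeField (2 * ℓ),
          LatticeGauge.IsPiFlux σ a b →
          LatticeGauge.IsPiFlux σ₀ (LatticeGauge.refFlux ℓ) (LatticeGauge.refFlux ℓ) →
          LatticeGauge.HasGroundStateEnergy ε t σ ∧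
          LatticeGauge.HasGroundStateEnergy 1 t σ₀ ∧
          |LatticeGauge.groundStateEnergy ε t σ - LatticeGauge.groundStateEnergy 1 t σ₀| ≤
            C * t / ((2 * ℓ : ℕ) : ℝ) ^ (1 - 3 * α)) := by
  constructor
  · intro t ht ℓ _ a b σ hσ β hβ
    rw [LatticeGauge.oddPartition_eq t β hσ.plaquette_eq]
    constructor
    · intro hab
      obtain ⟨rfl, rfl⟩ := Prod.mk.inj hab
      obtain ⟨k, hk⟩ := LatticeGauge.exists_eigenvalues_eq_zero t hσ
      rw [Finset.prod_eq_zero (Finset.mem_univ k) (by rw [hk]; simp), mul_zero, Complex.ofReal_zero]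
    · intro hab
      rw [← Complex.ofReal_zero, Complex.real_lt_real]
      exact mul_pos (Real.exp_pos _) (LatticeGauge.prod_one_sub_exp_pos hβ hσ.plaquette_eq
        (LatticeGauge.eigenvalues_ne_zero ht hσ hab))
  · intro α hα _
    -- Here `960 = 4 · 120 · 2`: the energy prefactor, the Riemann sum bound and the passage from
    -- `ℓ` to `L = 2ℓ`.
    refine ⟨960 * (1 + 1 / (3 * α)), by positivity, ?_⟩
    intro t ht ℓ _ ε a b hab σ σ₀ hσ hσ₀
    have h1 := LatticeGauge.tendsto_freeEnergy ht hσ hab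
    have h2 := LatticeGauge.tendsto_freeEnergy (ε := 1) ht hσ₀ (by simp)
    have e1 : LatticeGauge.groundStateEnergy ε t σ = _ := h1.limUnder_eq
    have e2 : LatticeGauge.groundStateEnergy 1 t σ₀ = _ := h2.limUnder_eq
    refine ⟨?_, ?_, ?_⟩
    · rw [LatticeGauge.HasGroundStateEnergy, e1]; exact h1
    · rw [LatticeGauge.HasGroundStateEnergy, e2]; exact h2
    · have hℓ := Nat.pos_of_neZero ℓ
      have h0 : LatticeGauge.fluxShift ℓ (LatticeGauge.refFlux ℓ) = 0 := if_pos rfl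
      have h3 := LatticeGauge.abs_coneSum_sub_coneSum_zero_le hℓ
        (LatticeGauge.fluxShift_eq (ℓ := ℓ) a) (LatticeGauge.fluxShift_eq (ℓ := ℓ) b)
      have h4 := LatticeGauge.one_add_log_div_le hℓ hα
      rw [e1, e2, h0, sub_sub_sub_cancel_left, ← mul_sub, abs_mul, abs_sub_comm,
        abs_of_pos (by positivity : 0 < 4 * t)]
      calc _ ≤ 4 * t * (120 * (1 + Real.log ℓ) / ℓ) := by gcongr
        _ = 480 * t * ((1 + Real.log ℓ) / ℓ) := by ring
        _ ≤ 480 * t * (2 * (1 + 1 / (3 * α)) / ((2 * ℓ : ℕ) : ℝ) ^ (1 - 3 * α)) := by gcongr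
        _ = _ := by ring
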